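/- Let $\Gamma$ be a finite simple graph with vertex set $X$, and let $G=G(\Gamma)$ be the partially commutative group (right-angled Artin group) with generating set $X$ and one relation $[x,y]=1$ for each pair of adjacent vertices $x,y$. Write $g^h=h^{-1}gh$ for $g,h\in G$. For $x\in X$ let $x^\perp$ be the set consisting of $x$ and all vertices adjacent to $x$, and let $[x]$ be the set of all $y\in X$ such that $y^\perp=x^\perp$ or $y^\perp\setminus\{y\}=x^\perp\setminus\{x\}$. Say that $x\in X$ dominates $u\in X$ if $x^\perp\cap u^\perp=u^\perp\setminus\{u\}$. Define the following subsets and subgroups of $\operatorname{Aut}(G)$. - $\operatorname{Conj}(G)$ is the subgroup of all $\phi\in\operatorname{Aut}(G)$ such that for every $x\in X$ there is $g_x\in G$ with $\phi(x)=x^{g_x}$. The vertex-conjugating subgroup $\operatorname{Conj}_V(G)$ is the subgroup of all $\phi\in\operatorname{Conj}(G)$ such that for every $x\in X$ there is $f_x\in G$ with $\phi(y)=y^{f_x}$ for all $y\in[x]$. - For $x\in X$, $\varepsilon=\pm1$ and $C$ the vertex set of a connected component of $\Gamma\setminus x^\perp$ (the full subgraph on $X\setminus x^\perp$), $\alpha_{C,x^\varepsilon}$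 is the automorphism of $G$ with $y\mapsto y^{x^\varepsilon}$ for $y\in C$ and $y\mapsto y$ for $y\in X\setminus C$. $\operatorname{LInn}(G)$ is the set of all these automorphisms, $\operatorname{LInn}_S(G)$ is the set of those with $|C|=1$, and $\operatorname{Conj}_S(G)=\langle\operatorname{LInn}_S(G)\rangle$. - The set of regular elementary conjugating automorphisms is $\operatorname{LInn}_R(G)=(\operatorname{LInn}(G)\cap\operatorname{Conj}_V(G))\setminus\operatorname{LInn}_S(G)$. - If $x$ dominates $u$, then $\{v\}$ is a connected component of $\Gamma\setminus x^\perp$ for every $v\in[u]\setminus\{x\}$, the automorphisms $\alpha_{\{v\},x}$ for these $v$ commute with one another, and $\alpha_{[u],x}=\prod_{v\in[u]\setminus\{x\}}\alpha_{\{v\},x}$ is called a basic collected conjugating automorphism. $\operatorname{LInn}_C(G)$ is the set of all $\alpha_{[u],x}$ with $x,u\in X$ and $x$ dominating $u$, and $\operatorname{Conj}_C(G)=\langle\operatorname{LInn}_C(G)\rangle$. Then $\operatorname{Conj}_V(G)$ is generated by $\operatorname{LInn}_R(G)\cup\operatorname{LInn}_C(G)$, and $\operatorname{Conj}_V(G)\cap\operatorname{Conj}_S(G)=\operatorname{Conj}_C(G)$.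 -/

import Mathlib

namespace PartComm

variable {V : Type*}

/-- The star `x^⊥` of a vertex: the vertices at distance at most one from `x`. -/
def star (Γ : SimpleGraph V) (x : V) : Set V := {y | y = x ∨ Γ.Adj x y}

/-- The defining relators: the commutators `[a, b] = a⁻¹ b⁻¹ a b` of adjacent vertices. -/
def rels (Γ : SimpleGraph V) : Set (FreeGroup V) :=
  {r | ∃ a b : V, Γ.Adj a b ∧
    r = (FreeGroup.of a)⁻¹ * (FreeGroup.of b)⁻¹ * FreeGroup.of a * FreeGroup.of b}

/-- The partially commutative group (right-angled Artin group) `G(Γ) = ⟨V | rels Γ⟩`. -/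
abbrev Grp (Γ : SimpleGraph V) : Type _ := PresentedGroup (rels Γ)

/-- The element of `G(Γ)` given by a vertex. -/
def gen (Γ : SimpleGraph V) (x : V) : Grp Γ := PresentedGroup.of x

theorem gen_comm (Γ : SimpleGraph V) {a b : V} (h : Γ.Adj a b) : Commute (gen Γ a) (gen Γ b) := by
  have h1 : (PresentedGroup.mk (rels Γ)) ((FreeGroup.of a)⁻¹ * (FreeGroup.of b)⁻¹ *
      FreeGroup.of a * FreeGroup.of b) = 1 :=
    PresentedGroup.one_of_mem ⟨a, b, h, rfl⟩
  have h2 : (gen Γ a)⁻¹ * (gen Γ b)⁻¹ * gen Γ a * gen Γ b = 1 := by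
    simp only [map_mul, map_inv] at h1
    exact h1
  have h3 : gen Γ a * gen Γ b = gen Γ b * gen Γ a := by
    calc gen Γ a * gen Γ b
        = gen Γ b * gen Γ a * ((gen Γ a)⁻¹ * (gen Γ b)⁻¹ * gen Γ a * gen Γ b) := by group
      _ = gen Γ b * gen Γ a := by rw [h2, mul_one]
  exact h3

/-- `C` is the vertex set of a connected component of `Γ` with the star of `x` removed. -/
def IsComponent (Γ : SimpleGraph V) (x : V) (C : Set V) : Prop :=
  ∃ c : (Γ.induce (star Γ x)ᶜ).ConnectedComponent, C = Subtype.val '' c.supp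

theorem IsComponent.disjoint {Γ : SimpleGraph V} {x : V} {C : Set V} (hC : IsComponent Γ x C)
    {a : V} (ha : a ∈ C) : a ∉ star Γ x := by
  obtain ⟨c, rfl⟩ := hC
  obtain ⟨a, -, rfl⟩ := ha
  exact a.2

theorem IsComponent.mem_of_adj {Γ : SimpleGraph V} {x : V} {C : Set V} (hC : IsComponent Γ x C)
    {a b : V} (h : Γ.Adj a b) (ha : a ∈ C) (hb : b ∉ star Γ x) : b ∈ C := by
  obtain ⟨c, rfl⟩ := hC
  obtain ⟨a, hac, rfl⟩ := ha
  refine ⟨⟨b, hb⟩, ?_, rfl⟩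
  have hadj : (Γ.induce (star Γ x)ᶜ).Adj a ⟨b, hb⟩ := h
  rw [SimpleGraph.ConnectedComponent.mem_supp_iff] at hac ⊢
  rw [← hac]
  exact SimpleGraph.ConnectedComponent.sound hadj.symm.reachable

open Classical in
/-- The image of a generator under the partial conjugation of `C` by `x ^ n`,
where `g ^ h = h⁻¹ g h`. -/
noncomputable def partialConjFun (Γ : SimpleGraph V) (x : V) (C : Set V) (n : ℤ) (y : V) : Grp Γ :=
  if y ∈ C then (gen Γ x ^ n)⁻¹ * gen Γ y * gen Γ x ^ n else gen Γ y

theorem partialConjFun_commute {Γ : SimpleGraph V} {x : V} {C : Set V} (hC : IsComponent Γ x C)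
    (n : ℤ) {a b : V} (h : Γ.Adj a b) :
    Commute (partialConjFun Γ x C n a) (partialConjFun Γ x C n b) := by
  have hab := gen_comm Γ h
  -- the mixed case: one endpoint in `C`, the other one not
  have key : ∀ {a b : V}, Γ.Adj a b → a ∈ C → b ∉ C →
      Commute ((gen Γ x ^ n)⁻¹ * gen Γ a * gen Γ x ^ n) (gen Γ b) := by
    intro a b h ha hb
    have hbx : Commute (gen Γ x) (gen Γ b) := by
      have hbs : b ∈ star Γ x := by
        by_contra hb'
        exact hb (hC.mem_of_adj h ha hb')
      rcases hbs with rfl | hbs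
      · exact Commute.refl _
      · exact gen_comm Γ hbs
    exact (((hbx.zpow_left n).inv_left).mul_left (gen_comm Γ h)).mul_left (hbx.zpow_left n)
  unfold partialConjFun
  split_ifs with ha hb hb
  · have e : (gen Γ x ^ n)⁻¹ * gen Γ a * gen Γ x ^ n * ((gen Γ x ^ n)⁻¹ * gen Γ b * gen Γ x ^ n) =
        (gen Γ x ^ n)⁻¹ * gen Γ b * gen Γ x ^ n *
          ((gen Γ x ^ n)⁻¹ * gen Γ a * gen Γ x ^ n) := by
      calc _ = (gen Γ x ^ n)⁻¹ * (gen Γ a * gen Γ b) * gen Γ x ^ n := by group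
        _ = (gen Γ x ^ n)⁻¹ * (gen Γ b * gen Γ a) * gen Γ x ^ n := by rw [hab.eq]
        _ = _ := by group
    exact e
  · exact key h ha hb
  · exact (key h.symm hb ha).symm
  · exact hab

/-- The endomorphism of `G(Γ)` conjugating every generator in `C` by `x ^ n` and fixing the
other generators. -/
noncomputable def partialConjHom (Γ : SimpleGraph V) (x : V) (C : Set V) (hC : IsComponent Γ x C)
    (n : ℤ) : Grp Γ →* Grp Γ :=
  PresentedGroup.toGroup (rels := rels Γ) (f := partialConjFun Γ x C n) (by
    rintro r ⟨a, b, h, rfl⟩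
    have hc := (partialConjFun_commute hC n h).eq
    simp only [map_mul, map_inv, FreeGroup.lift_apply_of]
    rw [mul_assoc, hc]
    group)

theorem partialConjHom_gen {Γ : SimpleGraph V} {x : V} {C : Set V} (hC : IsComponent Γ x C)
    (n : ℤ) (y : V) :
    partialConjHom Γ x C hC n (gen Γ y) = partialConjFun Γ x C n y :=
  PresentedGroup.toGroup.of _

theorem partialConjHom_gen_self {Γ : SimpleGraph V} {x : V} {C : Set V} (hC : IsComponent Γ x C)
    (n : ℤ) : partialConjHom Γ x C hC n (gen Γ x) = gen Γ x := by
  rw [partialConjHom_gen, partialConjFun, if_neg]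
  exact fun h => hC.disjoint h (Or.inl rfl)

theorem partialConjHom_comp {Γ : SimpleGraph V} {x : V} {C : Set V} (hC : IsComponent Γ x C)
    {m n : ℤ} (h : m + n = 0) :
    (partialConjHom Γ x C hC m).comp (partialConjHom Γ x C hC n) = MonoidHom.id _ := by
  refine PresentedGroup.ext fun y => ?_
  change partialConjHom Γ x C hC m (partialConjHom Γ x C hC n (gen Γ y)) = gen Γ y
  obtain rfl : m = -n := by omega
  rw [partialConjHom_gen, partialConjFun]
  split_ifs with hy
  · simp only [map_mul, map_inv, map_zpow, partialConjHom_gen_self]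
    rw [partialConjHom_gen, partialConjFun, if_pos hy]
    group
  · rw [partialConjHom_gen, partialConjFun, if_neg hy]

/-- The elementary conjugating automorphism `α_{C, x^ε}`, `ε = ±1`: it conjugates the generators
in the component `C` of `Γ ∖ x^⊥` by `x ^ ε` and fixes the other generators. -/
noncomputable def elemConj (Γ : SimpleGraph V) (x : V) (C : Set V) (hC : IsComponent Γ x C)
    (ε : ℤˣ) : MulAut (Grp Γ) :=
  MonoidHom.toMulEquiv (partialConjHom Γ x C hC ε) (partialConjHom Γ x C hC (-ε))
    (partialConjHom_comp hC (by ring)) (partialConjHom_comp hC (by ring))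

open Classical in
theorem elemConj_gen (Γ : SimpleGraph V) (x : V) (C : Set V) (hC : IsComponent Γ x C)
    (ε : ℤˣ) (y : V) :
    elemConj Γ x C hC ε (gen Γ y) =
      if y ∈ C then (gen Γ x ^ (ε : ℤ))⁻¹ * gen Γ y * gen Γ x ^ (ε : ℤ) else gen Γ y :=
  partialConjHom_gen hC ε y

/-- The set `LInn` of elementary conjugating automorphisms. -/
def LInn (Γ : SimpleGraph V) : Set (MulAut (Grp Γ)) :=
  {φ | ∃ (x : V) (C : Set V) (hC : IsComponent Γ x C) (ε : ℤˣ), φ = elemConj Γ x C hC ε}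

/-- The set `LInn_S` of elementary singular conjugating automorphisms: those `α_{C, x^ε}` with
`C` a single vertex. -/
def LInnS (Γ : SimpleGraph V) : Set (MulAut (Grp Γ)) :=
  {φ | ∃ (x y : V) (hC : IsComponent Γ x {y}) (ε : ℤˣ), φ = elemConj Γ x {y} hC ε}

/-- The subgroup `Conj_S` generated by `LInn_S`. -/
def ConjS (Γ : SimpleGraph V) : Subgroup (MulAut (Grp Γ)) := Subgroup.closure (LInnS Γ)

/-- The equivalence `x ∼ y` on vertices: equal stars or equal links. -/
def VEquiv (Γ : SimpleGraph V) (x y : V) : Prop :=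
  star Γ x = star Γ y ∨ star Γ x \ {x} = star Γ y \ {y}

/-- The class `[x]` of `x` under `∼`. -/
def vclass (Γ : SimpleGraph V) (x : V) : Set V := {y | VEquiv Γ x y}

theorem conj_mul_aux {Γ : SimpleGraph V} {φ ψ : MulAut (Grp Γ)} {y : V} {f g : Grp Γ}
    (hφ : φ (gen Γ y) = f⁻¹ * gen Γ y * f) (hψ : ψ (gen Γ y) = g⁻¹ * gen Γ y * g) :
    (φ * ψ) (gen Γ y) = (f * φ g)⁻¹ * gen Γ y * (f * φ g) := by
  rw [MulAut.mul_apply, hψ]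
  simp only [map_mul, map_inv, hφ]
  group

theorem conj_inv_aux {Γ : SimpleGraph V} {φ : MulAut (Grp Γ)} {y : V} {f : Grp Γ}
    (hφ : φ (gen Γ y) = f⁻¹ * gen Γ y * f) :
    φ⁻¹ (gen Γ y) = ((φ⁻¹ f)⁻¹)⁻¹ * gen Γ y * (φ⁻¹ f)⁻¹ := by
  have h : φ⁻¹ (φ (gen Γ y)) = gen Γ y := MulAut.inv_apply_self _ φ _
  rw [hφ] at h
  simp only [map_mul, map_inv] at h
  conv_rhs => rw [← h]
  group

/-- The group `Conj` of basis-conjugating automorphisms. -/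
def Conj (Γ : SimpleGraph V) : Subgroup (MulAut (Grp Γ)) where
  carrier := {φ | ∀ x : V, ∃ g : Grp Γ, φ (gen Γ x) = g⁻¹ * gen Γ x * g}
  one_mem' := fun x => ⟨1, by simp⟩
  mul_mem' := by
    intro φ ψ hφ hψ x
    obtain ⟨f, hf⟩ := hφ x
    obtain ⟨g, hg⟩ := hψ x
    exact ⟨_, conj_mul_aux hf hg⟩
  inv_mem' := by
    intro φ hφ x
    obtain ⟨f, hf⟩ := hφ x
    exact ⟨_, conj_inv_aux hf⟩

/-- The group `Conj_V` of vertex conjugating automorphisms: for every vertex `x` a single element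
`f` conjugates all the generators in `[x]`. -/
def ConjV (Γ : SimpleGraph V) : Subgroup (MulAut (Grp Γ)) where
  carrier := {φ | φ ∈ Conj Γ ∧
    ∀ x : V, ∃ f : Grp Γ, ∀ y ∈ vclass Γ x, φ (gen Γ y) = f⁻¹ * gen Γ y * f}
  one_mem' := ⟨one_mem _, fun x => ⟨1, by simp⟩⟩
  mul_mem' := by
    rintro φ ψ ⟨hφ, hφ'⟩ ⟨hψ, hψ'⟩
    refine ⟨mul_mem hφ hψ, fun x => ?_⟩
    obtain ⟨f, hf⟩ := hφ' x
    obtain ⟨g, hg⟩ := hψ' x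
    exact ⟨_, fun y hy => conj_mul_aux (hf y hy) (hg y hy)⟩
  inv_mem' := by
    rintro φ ⟨hφ, hφ'⟩
    refine ⟨inv_mem hφ, fun x => ?_⟩
    obtain ⟨f, hf⟩ := hφ' x
    exact ⟨_, fun y hy => conj_inv_aux (hf y hy)⟩

/-- The set `LInn_R` of regular elementary conjugating automorphisms. -/
def LInnR (Γ : SimpleGraph V) : Set (MulAut (Grp Γ)) := (LInn Γ ∩ ConjV Γ) \ LInnS Γ

/-- `x` dominates `u`: `x^⊥ ∩ u^⊥ = u^⊥ ∖ u`. -/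
def Dominates (Γ : SimpleGraph V) (x u : V) : Prop :=
  star Γ x ∩ star Γ u = star Γ u \ {u}

/-- If `x` dominates `u`, every `v ∈ [u] ∖ {x}` is a component of `Γ ∖ x^⊥`, so that
`α_{{v}, x}` makes sense. -/
theorem Dominates.isComponent {Γ : SimpleGraph V} {x u v : V} (h : Dominates Γ x u)
    (hv : v ∈ vclass Γ u \ {x}) : IsComponent Γ x {v} := by
  have hux : u ∉ star Γ x := fun hu => by
    have : u ∈ star Γ u \ {u} := h ▸ ⟨hu, Or.inl rfl⟩
    exact this.2 rfl
  have hsub : ∀ w, Γ.Adj u w → w ∈ star Γ x := fun w hw => by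
    have : w ∈ star Γ x ∩ star Γ u := by
      rw [h]
      exact ⟨Or.inr hw, fun e => hw.ne (Set.mem_singleton_iff.mp e).symm⟩
    exact this.1
  obtain ⟨hv, hvx⟩ := hv
  have hvx : v ≠ x := hvx
  have hadj : ∀ w, w ≠ u → w ≠ v → (Γ.Adj v w ↔ Γ.Adj u w) := by
    intro w hwu hwv
    have hv : star Γ u = star Γ v ∨ star Γ u \ {u} = star Γ v \ {v} := hv
    rcases hv with e | e
    · have := Set.ext_iff.mp e w
      simpa [star, hwu, hwv] using this.symm
    · have := Set.ext_iff.mp e w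
      simpa [star, hwu, hwv] using this.symm
  have hxu : x ≠ u := fun e => hux (Or.inl e.symm)
  have hv1 : v ∉ star Γ x := by
    rintro (e | e)
    · exact hvx e
    · exact hux (Or.inr ((hadj x hxu hvx.symm).mp e.symm).symm)
  have huv : ¬ Γ.Adj v u := fun e => hv1 (hsub v e.symm)
  have hiso : ∀ w, w ∉ star Γ x → ¬ Γ.Adj v w := by
    intro w hw e
    by_cases hwu : w = u
    · exact huv (hwu ▸ e)
    · exact hw (hsub w ((hadj w hwu e.ne').mp e))
  refine ⟨(Γ.induce (star Γ x)ᶜ).connectedComponentMk ⟨v, hv1⟩, ?_⟩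
  ext w
  simp only [Set.mem_singleton_iff, Set.mem_image, SimpleGraph.ConnectedComponent.mem_supp_iff]
  constructor
  · rintro rfl
    exact ⟨⟨w, hv1⟩, rfl, rfl⟩
  · rintro ⟨w, hw, rfl⟩
    obtain ⟨p⟩ := (SimpleGraph.ConnectedComponent.exact hw).symm
    cases p with
    | nil => rfl
    | @cons _ z _ e _ => exact absurd e (hiso _ z.2)

theorem elemConj_commute {Γ : SimpleGraph V} {x v w : V} (hv : IsComponent Γ x {v})
    (hw : IsComponent Γ x {w}) (ε : ℤˣ) :
    Commute (elemConj Γ x {v} hv ε) (elemConj Γ x {w} hw ε) := by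
  have hvx : ∀ {v : V} (hv : IsComponent Γ x {v}),
      elemConj Γ x {v} hv ε (gen Γ x) = gen Γ x := fun hv => partialConjHom_gen_self hv ε
  have key : ∀ y, (elemConj Γ x {v} hv ε) ((elemConj Γ x {w} hw ε) (gen Γ y)) =
      (elemConj Γ x {w} hw ε) ((elemConj Γ x {v} hv ε) (gen Γ y)) := by
    intro y
    by_cases h1 : y ∈ ({v} : Set V) <;> by_cases h2 : y ∈ ({w} : Set V) <;>
      simp [elemConj_gen, hvx, h1, h2]
  refine MulEquiv.toMonoidHom_injective (PresentedGroup.ext fun y => ?_)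
  exact key y

theorem Dominates.pairwise_commute [Finite V] {Γ : SimpleGraph V} {x u : V} (h : Dominates Γ x u)
    (s : Finset {v // v ∈ (Set.toFinite (vclass Γ u \ {x})).toFinset}) :
    (s : Set {v // v ∈ (Set.toFinite (vclass Γ u \ {x})).toFinset}).Pairwise
      (Function.onFun Commute fun v =>
        elemConj Γ x {v.1} (h.isComponent ((Set.Finite.mem_toFinset _).mp v.2)) 1) :=
  fun _ _ _ _ _ => elemConj_commute _ _ 1

/-- The basic collected conjugating automorphism `α_{[u], x}`, where `x` dominates `u`: the product
of the (pairwise commuting) automorphisms `α_{{v}, x}` over all `v ∈ [u] ∖ {x}`. -/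
noncomputable def collectedConj [Finite V] (Γ : SimpleGraph V) (x u : V) (h : Dominates Γ x u) :
    MulAut (Grp Γ) :=
  (Set.toFinite (vclass Γ u \ {x})).toFinset.attach.noncommProd
    (fun v => elemConj Γ x {v.1} (h.isComponent ((Set.Finite.mem_toFinset _).mp v.2)) 1)
    (h.pairwise_commute _)

/-- The set `LInn_C` of basic collected conjugating automorphisms. -/
def LInnC [Finite V] (Γ : SimpleGraph V) : Set (MulAut (Grp Γ)) :=
  {φ | ∃ (x u : V) (h : Dominates Γ x u), φ = collectedConj Γ x u h}

/-- The subgroup `Conj_C` generated by `LInn_C`. -/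
def ConjC [Finite V] (Γ : SimpleGraph V) : Subgroup (MulAut (Grp Γ)) :=
  Subgroup.closure (LInnC Γ)

end PartComm

/-! The proof is a peak reduction on the walls of the group. Reduced words up to shuffles are normal
forms, so `lead x g`, the exponent of the largest power of `x` that can start `g`, is well defined.
The conjugate `x ^ g` has a carrier, the coset of the star subgroup of `x` through `g⁻¹`. The
integer `sector x g a` records on which side of the corresponding parallel walls `a` lies, relative
to `1`. Carriers for distinct non-adjacent vertices are nested (`sector_nested`).

Let `φ` send each `x` to `x ^ g_x`. If no wall of `y ^ g_y` separates `1` from the carrier of `x ^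
g_x` for any `y` outside `x^⊥`, then `φ` preserves leading exponents and is the identity
(`exists_sector_ne_zero`). Otherwise some `y` separates. Precomposing `φ` with conjugation of `x` by
`y^±1` pulls the carrier back across the wall, so the conjugator gets shorter (`exists_shorter`,
`conjLen_lt`). The position is constant along the component of `x` in `Γ ∖ y^⊥`, and along `[x]`
when `φ` is vertex conjugating, so a whole regular or collected automorphism lowers the total
length. Induction on that length gives generation.

For the intersection, products of singular automorphisms conjugate `u` by words in vertices whose
links contain the link of `u`. A separating `y` is then one of these and dominates `x`, so collected
automorphisms suffice. -/

namespace PartComm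

/-! ### Words up to shuffling, reduction and leading exponents -/

section Words

open Classical

variable {V : Type*} (Γ : SimpleGraph V)

/-- The formal inverse of a letter. -/
def linv (a : V × Bool) : V × Bool := (a.1, !a.2)

/-- The exponent `±1` of a letter. -/
def sgn (b : Bool) : ℤ := cond b 1 (-1)

@[simp] theorem sgn_true : sgn true = 1 := rfl

@[simp] theorem sgn_false : sgn false = -1 := rfl

@[simp] theorem linv_fst (a : V × Bool) : (linv a).1 = a.1 := rfl

@[simp] theorem linv_linv (a : V × Bool) : linv (linv a) = a := by
  simp [linv]

/-- Equality of words up to exchanging neighbouring letters whose vertices are adjacent. -/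
inductive Shuffle : List (V × Bool) → List (V × Bool) → Prop
  | refl (l : List (V × Bool)) : Shuffle l l
  | swap (a b : V × Bool) (l : List (V × Bool)) (h : Γ.Adj a.1 b.1) :
      Shuffle (a :: b :: l) (b :: a :: l)
  | cons (a : V × Bool) {l l' : List (V × Bool)} (h : Shuffle l l') : Shuffle (a :: l) (a :: l')
  | trans {l l' l'' : List (V × Bool)} (h : Shuffle l l') (h' : Shuffle l' l'') : Shuffle l l''

theorem Shuffle.symm {l l' : List (V × Bool)} (h : Shuffle Γ l l') : Shuffle Γ l' l := by
  induction h with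
  | refl l => exact .refl l
  | swap a b l h => exact .swap b a l h.symm
  | cons a _ ih => exact .cons a ih
  | trans _ _ ih ih' => exact .trans ih' ih

/-- The letter `a` can be brought to the front of the word by exchanges. -/
def Avail (a : V × Bool) : List (V × Bool) → Prop
  | [] => False
  | b :: l => b = a ∨ (Γ.Adj b.1 a.1 ∧ Avail a l)

/-- A word is reduced if no letter can be cancelled after exchanges. -/
def Reduced : List (V × Bool) → Prop
  | [] => True
  | a :: l => ¬ Avail Γ (linv a) l ∧ Reduced l

/-- The total exponent of the letters `x^±1` that can be brought to the front of the word. -/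
noncomputable def leadWord (x : V) : List (V × Bool) → ℤ
  | [] => 0
  | b :: l => if b.1 = x then sgn b.2 + leadWord x l else if Γ.Adj b.1 x then leadWord x l else 0

variable {Γ}

theorem Avail.shuffle {a : V × Bool} {l : List (V × Bool)} (h : Avail Γ a l) :
    Shuffle Γ l (a :: l.erase a) := by
  induction l with
  | nil => exact h.elim
  | cons b l ih =>
    by_cases hb : b = a
    · subst hb
      simpa using Shuffle.refl _
    · rcases h with h | ⟨h, h'⟩
      · exact absurd h hb
      · rw [List.erase_cons_tail (by simpa using hb)]
        exact (Shuffle.cons b (ih h')).trans (Shuffle.swap _ _ _ h)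

theorem Shuffle.avail_iff {l l' : List (V × Bool)} (h : Shuffle Γ l l') (a : V × Bool) :
    Avail Γ a l ↔ Avail Γ a l' := by
  induction h with
  | refl l => rfl
  | swap b c l h =>
    simp only [Avail]
    have hs := h.symm
    constructor
    · rintro (rfl | ⟨h1, rfl | h2⟩) <;> tauto
    · rintro (rfl | ⟨h1, rfl | h2⟩) <;> tauto
  | cons b _ ih => simp only [Avail, ih]
  | trans _ _ ih ih' => exact ih.trans ih'

theorem Shuffle.erase {l l' : List (V × Bool)} (h : Shuffle Γ l l') (a : V × Bool) :
    Shuffle Γ (l.erase a) (l'.erase a) := by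
  induction h with
  | refl l => exact .refl _
  | swap b c l h =>
    by_cases hb : b = a
    · subst hb
      have : ¬ c = b := fun e => h.ne (by rw [e])
      rw [List.erase_cons_head, List.erase_cons_tail (by simpa using this), List.erase_cons_head]
      exact .refl _
    · by_cases hc : c = a
      · subst hc
        rw [List.erase_cons_head, List.erase_cons_tail (by simpa using hb), List.erase_cons_head]
        exact .refl _
      · rw [List.erase_cons_tail (by simpa using hb), List.erase_cons_tail (by simpa using hc),
          List.erase_cons_tail (by simpa using hc), List.erase_cons_tail (by simpa using hb)]
        exact .swap _ _ _ h
  | @cons b l l' h ih =>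
    by_cases hb : b = a
    · subst hb
      simpa using h
    · rw [List.erase_cons_tail (by simpa using hb), List.erase_cons_tail (by simpa using hb)]
      exact ih.cons b
  | trans _ _ ih ih' => exact ih.trans ih'

theorem avail_cons_of_adj {a b : V × Bool} (h : Γ.Adj a.1 b.1) (l : List (V × Bool)) :
    Avail Γ b (a :: l) ↔ Avail Γ b l := by
  have : a ≠ b := fun e => h.ne (by rw [e])
  simp [Avail, this, h]

theorem Shuffle.reduced_iff {l l' : List (V × Bool)} (h : Shuffle Γ l l') :
    Reduced Γ l ↔ Reduced Γ l' := by
  induction h with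
  | refl l => rfl
  | swap b c l h =>
    have h1 : Avail Γ (linv b) (c :: l) ↔ Avail Γ (linv b) l := 
      avail_cons_of_adj (b := linv b) h.symm l
    have h2 : Avail Γ (linv c) (b :: l) ↔ Avail Γ (linv c) l :=
      avail_cons_of_adj (b := linv c) h l
    simp only [Reduced, h1, h2]
    tauto
  | cons b h ih => simp only [Reduced, ih, h.avail_iff]
  | trans _ _ ih ih' => exact ih.trans ih'

theorem Shuffle.leadWord_eq {l l' : List (V × Bool)} (h : Shuffle Γ l l') (x : V) :
    leadWord Γ x l = leadWord Γ x l' := by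
  induction h with
  | refl l => rfl
  | swap b c l h =>
    simp only [leadWord]
    by_cases hb : b.1 = x
    · subst hb
      simp [h.symm, h.ne']
    · by_cases hc : c.1 = x
      · subst hc
        simp [h, h.ne]
      · simp only [hb, hc, if_false]
        split_ifs <;> rfl
  | cons b _ ih => simp only [leadWord, ih]
  | trans _ _ ih ih' => exact ih.trans ih'

variable (Γ) in
/-- Left multiplication of a reduced word by a letter. -/
noncomputable def letterMul (a : V × Bool) (l : List (V × Bool)) : List (V × Bool) :=
  if Avail Γ (linv a) l then l.erase (linv a) else a :: l

theorem Reduced.letterMul {l : List (V × Bool)} (h : Reduced Γ l) (a : V × Bool) :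
    Reduced Γ (letterMul Γ a l) := by
  unfold PartComm.letterMul
  split_ifs with h'
  · exact (h'.shuffle.reduced_iff.mp h).2
  · exact ⟨h', h⟩

theorem Shuffle.letterMul {l l' : List (V × Bool)} (h : Shuffle Γ l l') (a : V × Bool) :
    Shuffle Γ (letterMul Γ a l) (letterMul Γ a l') := by
  unfold PartComm.letterMul
  rw [h.avail_iff]
  split_ifs
  · exact h.erase _
  · exact h.cons a

/-- If the first multiplication cancels a letter, reducedness prevents another cancellation, so the
second multiplication puts the letter back. -/
theorem letterMul_linv {l : List (V × Bool)} (h : Reduced Γ l) (a : V × Bool) :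
    Shuffle Γ (letterMul Γ (linv a) (letterMul Γ a l)) l := by
  by_cases h' : Avail Γ (linv a) l
  · have hs := h'.shuffle
    have hr : ¬ Avail Γ (linv (linv a)) (l.erase (linv a)) := (hs.reduced_iff.mp h).1
    rw [letterMul, letterMul, if_pos h', if_neg hr]
    exact hs.symm
  · rw [letterMul, letterMul, if_neg h', if_pos (by simp [Avail]), linv_linv,
      List.erase_cons_head]
    exact .refl _

theorem avail_letterMul {a b : V × Bool} (h : Γ.Adj a.1 b.1) (l : List (V × Bool)) :
    Avail Γ b (letterMul Γ a l) ↔ Avail Γ b l := by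
  unfold letterMul
  split_ifs with h'
  · rw [h'.shuffle.avail_iff b]
    exact (avail_cons_of_adj (a := linv a) h _).symm
  · exact avail_cons_of_adj h l

/-- Neither multiplication affects whether the other cancels. This makes the defining relations hold
for the action on normal forms. -/
theorem letterMul_comm {a b : V × Bool} (h : Γ.Adj a.1 b.1) (l : List (V × Bool)) :
    Shuffle Γ (letterMul Γ a (letterMul Γ b l)) (letterMul Γ b (letterMul Γ a l)) := by
  have h1 := avail_letterMul (a := b) (b := linv a) h.symm l
  have h2 := avail_letterMul (a := a) (b := linv b) h l
  have ha : ¬ b = linv a := fun e => h.ne (by rw [e]; rfl)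
  have hb : ¬ a = linv b := fun e => h.ne (by rw [e]; rfl)
  rw [letterMul, h1, letterMul.eq_1 Γ b (letterMul Γ a l), h2, letterMul.eq_1 Γ b l,
    letterMul.eq_1 Γ a l]
  by_cases c1 : Avail Γ (linv a) l <;> by_cases c2 : Avail Γ (linv b) l <;>
    simp only [c1, c2, if_true, if_false]
  · rw [List.erase_comm]
    exact .refl _
  · rw [List.erase_cons_tail (by simpa using ha)]
    exact .refl _
  · rw [List.erase_cons_tail (by simpa using hb)]
    exact .refl _
  · exact .swap _ _ _ h

theorem leadWord_letterMul_self (a : V × Bool) (l : List (V × Bool)) :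
    leadWord Γ a.1 (letterMul Γ a l) = leadWord Γ a.1 l + sgn a.2 := by
  unfold letterMul
  split_ifs with h'
  · have := h'.shuffle.leadWord_eq a.1
    rw [this, leadWord, if_pos (linv_fst a)]
    rcases a with ⟨x, b⟩
    cases b <;> simp [linv]
  · simp [leadWord, add_comm]

theorem leadWord_letterMul_adj {a : V × Bool} {x : V} (h : Γ.Adj a.1 x) (l : List (V × Bool)) :
    leadWord Γ x (letterMul Γ a l) = leadWord Γ x l := by
  unfold letterMul
  split_ifs with h'
  · have := h'.shuffle.leadWord_eq x
    rw [this, leadWord, if_neg (by simpa using h.ne), if_pos (by simpa using h)]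
  · simp [leadWord, h.ne, h]

/-- Whichever of `x` and `y` occurs first in the word blocks the other from the front. The nesting
of walls rests on this. -/
theorem leadWord_eq_zero_of_ne_zero {x y : V} (hxy : x ≠ y) (hadj : ¬ Γ.Adj x y)
    {l : List (V × Bool)} (h : leadWord Γ y l ≠ 0) : leadWord Γ x l = 0 := by
  induction l with
  | nil => rfl
  | cons b l ih =>
    simp only [leadWord] at h ⊢
    by_cases hb : b.1 = x
    · subst hb
      simp [hxy, hadj] at h
    · by_cases hc : b.1 = y
      · subst hc
        have hd : ¬ Γ.Adj b.1 x := fun h => hadj h.symm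
        simp [hb, hd]
      · by_cases hd : Γ.Adj b.1 y
        · simp only [hc, hd, if_true, if_false] at h
          simp [hb, ih h]
        · simp [hc, hd] at h

/-- Letters `x^±1` that reach the front commute past everything between them, so in a reduced word
they share one sign and their sum cannot hide a cancellation. -/
theorem Reduced.leadWord_sign {l : List (V × Bool)} (h : Reduced Γ l) (x : V) :
    (0 < leadWord Γ x l → Avail Γ (x, true) l) ∧ (leadWord Γ x l < 0 → Avail Γ (x, false) l) := by
  induction l with
  | nil => simp [leadWord]
  | cons b l ih =>
    obtain ⟨h1, h2⟩ := h
    obtain ⟨i1, i2⟩ := ih h2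
    simp only [leadWord, Avail]
    rcases b with ⟨z, b⟩
    by_cases hb : z = x
    · subst hb
      cases b
      · have : ¬ 0 < leadWord Γ z l := fun e => h1 (i1 e)
        simp only [if_true, sgn_false, true_or, implies_true, and_true]
        intro; omega
      · have : ¬ leadWord Γ z l < 0 := fun e => h1 (i2 e)
        simp only [if_true, sgn_true, true_or, implies_true, true_and]
        intro; omega
    · by_cases hd : Γ.Adj z x
      · simp only [hb, hd, if_true, if_false, true_and]
        exact ⟨fun e => Or.inr (i1 e), fun e => Or.inr (i2 e)⟩
      · simp [hb, hd]

theorem Reduced.leadWord_cons_ne_zero {a : V × Bool} {l : List (V × Bool)}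
    (h : Reduced Γ (a :: l)) : leadWord Γ a.1 (a :: l) ≠ 0 := by
  obtain ⟨h1, h2⟩ := h
  obtain ⟨i1, i2⟩ := h2.leadWord_sign a.1
  rcases a with ⟨z, b⟩
  simp only [leadWord, if_true]
  cases b
  · have : ¬ 0 < leadWord Γ z l := fun e => h1 (i1 e)
    simp only [sgn_false]; omega
  · have : ¬ leadWord Γ z l < 0 := fun e => h1 (i2 e)
    simp only [sgn_true]; omega

theorem leadWord_eq_zero_of_forall {x : V} {l : List (V × Bool)} (h : ∀ a ∈ l, a.1 ≠ x) :
    leadWord Γ x l = 0 := by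
  induction l with
  | nil => rfl
  | cons b l ih =>
    simp only [List.mem_cons, forall_eq_or_imp] at h
    simp [leadWord, h.1, ih h.2]

/-! ### The action on normal forms, and leading exponents of group elements -/

variable (Γ) in
/-- Shuffle equivalence of reduced words. -/
def shuffleSetoid : Setoid {l : List (V × Bool) // Reduced Γ l} where
  r l l' := Shuffle Γ l.1 l'.1
  iseqv := ⟨fun l => .refl l.1, fun h => h.symm, fun h h' => h.trans h'⟩

variable (Γ) in
/-- Reduced words up to shuffles: the normal forms of the elements of the group. -/
def NormalForm : Type _ := Quotient (shuffleSetoid Γ)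

/-- The normal form of a reduced word. -/
def NormalForm.mk (l : List (V × Bool)) (h : Reduced Γ l) : NormalForm Γ :=
  Quotient.mk (shuffleSetoid Γ) ⟨l, h⟩

theorem NormalForm.sound {l l' : List (V × Bool)} (h : Reduced Γ l) (h' : Reduced Γ l')
    (e : Shuffle Γ l l') : NormalForm.mk l h = NormalForm.mk l' h' :=
  Quotient.sound (s := shuffleSetoid Γ) e

/-- Left multiplication of normal forms by a letter. -/
noncomputable def NormalForm.mul (a : V × Bool) : NormalForm Γ → NormalForm Γ :=
  Quotient.lift (fun w => NormalForm.mk (letterMul Γ a w.1) (w.2.letterMul a))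
    (fun _ _ e => NormalForm.sound _ _ (Shuffle.letterMul e a))

theorem NormalForm.mul_mk (a : V × Bool) {l : List (V × Bool)} (h : Reduced Γ l) :
    NormalForm.mul a (NormalForm.mk l h) = NormalForm.mk (letterMul Γ a l) (h.letterMul a) := rfl

theorem NormalForm.ind {p : NormalForm Γ → Prop}
    (h : ∀ l (hl : Reduced Γ l), p (NormalForm.mk l hl)) (w : NormalForm Γ) : p w :=
  Quotient.ind (fun l => h l.1 l.2) w

theorem NormalForm.mul_linv (a : V × Bool) (w : NormalForm Γ) :
    NormalForm.mul (linv a) (NormalForm.mul a w) = w := by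
  induction w using NormalForm.ind with
  | h l hl => exact NormalForm.sound _ _ (letterMul_linv hl a)

theorem NormalForm.mul_comm {a b : V × Bool} (h : Γ.Adj a.1 b.1) (w : NormalForm Γ) :
    NormalForm.mul a (NormalForm.mul b w) = NormalForm.mul b (NormalForm.mul a w) := by
  induction w using NormalForm.ind with
  | h l hl => exact NormalForm.sound _ _ (letterMul_comm h l)

variable (Γ) in
/-- The permutation of normal forms given by a vertex. -/
noncomputable def genPerm (x : V) : Equiv.Perm (NormalForm Γ) where
  toFun := NormalForm.mul (x, true)
  invFun := NormalForm.mul (x, false)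
  left_inv := NormalForm.mul_linv (x, true)
  right_inv := NormalForm.mul_linv (x, false)

theorem genPerm_comm {x y : V} (h : Γ.Adj x y) : Commute (genPerm Γ x) (genPerm Γ y) :=
  Equiv.ext fun w => NormalForm.mul_comm (a := (x, true)) (b := (y, true)) h w

variable (Γ) in
/-- The action of the group on normal forms by left multiplication. -/
noncomputable def normalAct : Grp Γ →* Equiv.Perm (NormalForm Γ) :=
  PresentedGroup.toGroup (rels := rels Γ) (f := genPerm Γ) (by
    rintro r ⟨a, b, h, rfl⟩
    have hc := (genPerm_comm h).eq
    simp only [map_mul, map_inv, FreeGroup.lift_apply_of]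
    rw [mul_assoc, hc]
    group)

theorem normalAct_gen (x : V) : normalAct Γ (gen Γ x) = genPerm Γ x :=
  PresentedGroup.toGroup.of _

variable (Γ) in
/-- The group element of a letter. -/
def letter (a : V × Bool) : Grp Γ := gen Γ a.1 ^ sgn a.2

variable (Γ) in
/-- The group element of a word. -/
def evalWord (l : List (V × Bool)) : Grp Γ := (l.map (letter Γ)).prod

@[simp] theorem evalWord_nil : evalWord Γ [] = 1 := rfl

@[simp] theorem evalWord_cons (a : V × Bool) (l : List (V × Bool)) :
    evalWord Γ (a :: l) = letter Γ a * evalWord Γ l := by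
  simp [evalWord]

theorem letter_linv (a : V × Bool) : letter Γ (linv a) = (letter Γ a)⁻¹ := by
  rcases a with ⟨x, b⟩
  cases b <;> simp [letter, linv]

theorem normalAct_letter (a : V × Bool) (w : NormalForm Γ) :
    normalAct Γ (letter Γ a) w = NormalForm.mul a w := by
  rcases a with ⟨x, b⟩
  cases b <;> simp [letter, normalAct_gen] <;> rfl

theorem letter_comm {a b : V × Bool} (h : Γ.Adj a.1 b.1) :
    Commute (letter Γ a) (letter Γ b) :=
  ((gen_comm Γ h).zpow_left _).zpow_right _

theorem Shuffle.evalWord_eq {l l' : List (V × Bool)} (h : Shuffle Γ l l') :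
    evalWord Γ l = evalWord Γ l' := by
  induction h with
  | refl l => rfl
  | swap b c l h => simp [← mul_assoc, (letter_comm h).eq]
  | cons b _ ih => simp [ih]
  | trans _ _ ih ih' => exact ih.trans ih'

theorem evalWord_letterMul (a : V × Bool) (l : List (V × Bool)) :
    evalWord Γ (letterMul Γ a l) = letter Γ a * evalWord Γ l := by
  unfold letterMul
  split_ifs with h
  · rw [h.shuffle.evalWord_eq]
    simp [letter_linv]
  · simp

/-- Every element is the product of a list of letters. -/
theorem exists_evalWord (g : Grp Γ) : ∃ l, evalWord Γ l = g := by
  have hg : g ∈ Subgroup.closure (Set.range (gen Γ)) := by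
    have := PresentedGroup.closure_range_of (rels Γ)
    change g ∈ Subgroup.closure (Set.range (PresentedGroup.of (rels := rels Γ)))
    rw [this]
    trivial
  induction hg using Subgroup.closure_induction_left with
  | one => exact ⟨[], rfl⟩
  | mul_left x hx y _ ih =>
    obtain ⟨z, rfl⟩ := hx
    obtain ⟨l, rfl⟩ := ih
    exact ⟨(z, true) :: l, by simp [letter]⟩
  | inv_mul_cancel x hx y _ ih =>
    obtain ⟨z, rfl⟩ := hx
    obtain ⟨l, rfl⟩ := ih
    exact ⟨(z, false) :: l, by simp [letter]⟩

/-- Acting on the empty word recovers the normal form from the group element, so quantities read off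
reduced words depend only on the element. -/
theorem normalAct_reduced {l : List (V × Bool)} (h : Reduced Γ l) :
    normalAct Γ (evalWord Γ l) (NormalForm.mk [] trivial) = NormalForm.mk l h := by
  induction l with
  | nil => simp
  | cons a l ih =>
    rw [evalWord_cons, map_mul, Equiv.Perm.mul_apply, ih h.2, normalAct_letter,
      NormalForm.mul_mk]
    have : letterMul Γ a l = a :: l := if_neg h.1
    exact NormalForm.sound _ _ (this ▸ .refl _)

/-- Every word can be reduced without introducing new letters. -/
theorem exists_reduced_subset (l : List (V × Bool)) :
    ∃ l', Reduced Γ l' ∧ evalWord Γ l' = evalWord Γ l ∧ l' ⊆ l := by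
  induction l with
  | nil => exact ⟨[], trivial, rfl, fun _ h => h⟩
  | cons a l ih =>
    obtain ⟨l', h1, h2, h3⟩ := ih
    refine ⟨letterMul Γ a l', h1.letterMul a, ?_, ?_⟩
    · rw [evalWord_letterMul, h2, evalWord_cons]
    · unfold letterMul
      split_ifs
      · exact fun b hb => List.mem_cons_of_mem _ (h3 (List.erase_subset hb))
      · exact List.cons_subset_cons a h3

theorem exists_reduced (g : Grp Γ) : ∃ l, Reduced Γ l ∧ evalWord Γ l = g := by
  obtain ⟨l, rfl⟩ := exists_evalWord g
  obtain ⟨l', h1, h2, -⟩ := exists_reduced_subset (Γ := Γ) l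
  exact ⟨l', h1, h2⟩

/-- The leading exponent of `x` in a normal form. -/
noncomputable def NormalForm.lead (x : V) : NormalForm Γ → ℤ :=
  Quotient.lift (fun w => leadWord Γ x w.1) (fun _ _ e => Shuffle.leadWord_eq e x)

variable (Γ) in
/-- The exponent of the largest power of `x` that starts a reduced word of `g`. -/
noncomputable def lead (x : V) (g : Grp Γ) : ℤ :=
  (normalAct Γ g (NormalForm.mk [] trivial)).lead x

theorem lead_evalWord {l : List (V × Bool)} (h : Reduced Γ l) (x : V) :
    lead Γ x (evalWord Γ l) = leadWord Γ x l := by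
  rw [lead, normalAct_reduced h]
  rfl

theorem lead_letter_mul (a : V × Bool) (g : Grp Γ) :
    lead Γ a.1 (letter Γ a * g) = lead Γ a.1 g + sgn a.2 := by
  obtain ⟨l, h, rfl⟩ := exists_reduced g
  rw [← evalWord_letterMul, lead_evalWord (h.letterMul a), lead_evalWord h,
    leadWord_letterMul_self]

theorem lead_letter_mul_adj {a : V × Bool} {x : V} (hx : Γ.Adj a.1 x) (g : Grp Γ) :
    lead Γ x (letter Γ a * g) = lead Γ x g := by
  obtain ⟨l, h, rfl⟩ := exists_reduced g
  rw [← evalWord_letterMul, lead_evalWord (h.letterMul a), lead_evalWord h,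
    leadWord_letterMul_adj hx]

theorem lead_eq_zero_of_ne_zero {x y : V} (hxy : x ≠ y) (hadj : ¬ Γ.Adj x y) {g : Grp Γ}
    (h : lead Γ y g ≠ 0) : lead Γ x g = 0 := by
  obtain ⟨l, hl, rfl⟩ := exists_reduced g
  rw [lead_evalWord hl] at h ⊢
  exact leadWord_eq_zero_of_ne_zero hxy hadj h

@[simp] theorem lead_one (x : V) : lead Γ x 1 = 0 :=
  lead_evalWord (l := []) trivial x

theorem eq_one_of_lead_eq_zero {g : Grp Γ} (h : ∀ x, lead Γ x g = 0) : g = 1 := by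
  obtain ⟨l, hl, rfl⟩ := exists_reduced g
  cases l with
  | nil => rfl
  | cons a l => exact absurd (lead_evalWord hl a.1 ▸ h a.1) hl.leadWord_cons_ne_zero

variable (Γ) in
/-- The subgroup generated by a set of vertices. -/
def span (T : Set V) : Subgroup (Grp Γ) := Subgroup.closure (gen Γ '' T)

theorem gen_mem_span {T : Set V} {x : V} (h : x ∈ T) : gen Γ x ∈ span Γ T :=
  Subgroup.subset_closure ⟨x, h, rfl⟩

theorem letter_mem_span {T : Set V} {a : V × Bool} (h : a.1 ∈ T) : letter Γ a ∈ span Γ T :=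
  zpow_mem (gen_mem_span h) _

theorem exists_evalWord_of_mem_span {T : Set V} {g : Grp Γ} (hg : g ∈ span Γ T) :
    ∃ l : List (V × Bool), evalWord Γ l = g ∧ ∀ a ∈ l, a.1 ∈ T := by
  induction hg using Subgroup.closure_induction_left with
  | one => exact ⟨[], rfl, by simp⟩
  | mul_left x hx y _ ih =>
    obtain ⟨z, hz, rfl⟩ := hx
    obtain ⟨l, rfl, hl⟩ := ih
    exact ⟨(z, true) :: l, by simp [letter], by simpa [hz] using hl⟩
  | inv_mul_cancel x hx y _ ih =>
    obtain ⟨z, hz, rfl⟩ := hx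
    obtain ⟨l, rfl, hl⟩ := ih
    exact ⟨(z, false) :: l, by simp [letter], by simpa [hz] using hl⟩

theorem lead_eq_zero_of_mem_span {T : Set V} {g : Grp Γ} (hg : g ∈ span Γ T) {x : V}
    (hx : x ∉ T) : lead Γ x g = 0 := by
  obtain ⟨l, rfl, hl⟩ := exists_evalWord_of_mem_span hg
  obtain ⟨l', h1, h2, h3⟩ := exists_reduced_subset (Γ := Γ) l
  rw [← h2, lead_evalWord h1]
  exact leadWord_eq_zero_of_forall fun a ha e => hx (e ▸ hl a (h3 ha))

end Words

/-! ### Walls, centralizers and nesting -/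

section Walls

open Classical

variable {V : Type*} {Γ : SimpleGraph V}

theorem self_mem_star (x : V) : x ∈ star Γ x := Or.inl rfl

theorem not_mem_star_comm {x y : V} (h : y ∉ star Γ x) : x ∉ star Γ y := by
  rintro (rfl | e)
  · exact h (Or.inl rfl)
  · exact h (Or.inr e.symm)

theorem lead_eq_zero_of_not_mem_star {x y : V} (hxy : y ∉ star Γ x) {g : Grp Γ}
    (h : lead Γ y g ≠ 0) : lead Γ x g = 0 :=
  lead_eq_zero_of_ne_zero (fun e => hxy (Or.inl e.symm)) (fun e => hxy (Or.inr e)) h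

theorem commute_gen_of_mem_star {x y : V} (h : y ∈ star Γ x) : Commute (gen Γ y) (gen Γ x) := by
  rcases h with rfl | h
  · exact .refl _
  · exact (gen_comm Γ h).symm

theorem commute_of_mem_span_star {x : V} {g : Grp Γ} (hg : g ∈ span Γ (star Γ x)) :
    Commute g (gen Γ x) := by
  induction hg using Subgroup.closure_induction with
  | mem y hy =>
    obtain ⟨z, hz, rfl⟩ := hy
    exact commute_gen_of_mem_star hz
  | one => exact .one_left _
  | mul a b _ _ ha hb => exact ha.mul_left hb
  | inv a _ ha => exact ha.inv_left

/-- Multiplication by an element of the star subgroup of `x` translates the exponent of `x`. -/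
theorem exists_lead_mul_eq_add {x : V} {c : Grp Γ} (hc : c ∈ span Γ (star Γ x)) :
    ∃ e : ℤ, ∀ b, lead Γ x (c * b) = lead Γ x b + e := by
  obtain ⟨l, rfl, hl⟩ := exists_evalWord_of_mem_span hc
  clear hc
  induction l with
  | nil => exact ⟨0, by simp⟩
  | cons a l ih =>
    simp only [List.mem_cons, forall_eq_or_imp] at hl
    obtain ⟨e, he⟩ := ih hl.2
    rcases hl.1 with h | h
    · subst h
      refine ⟨e + sgn a.2, fun b => ?_⟩
      rw [evalWord_cons, mul_assoc, lead_letter_mul, he, add_assoc]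
    · refine ⟨e, fun b => ?_⟩
      rw [evalWord_cons, mul_assoc, lead_letter_mul_adj h.symm, he]

theorem lead_cons_ne_zero {a : V × Bool} {l : List (V × Bool)} (h : Reduced Γ (a :: l)) :
    lead Γ a.1 (evalWord Γ (a :: l)) ≠ 0 :=
  lead_evalWord h a.1 ▸ h.leadWord_cons_ne_zero

theorem vertex_eq_of_lead_letter_ne_zero {y : V} (a : V × Bool) (h : lead Γ y (letter Γ a) ≠ 0) :
    a.1 = y := by
  by_contra hne
  refine h (lead_eq_zero_of_mem_span (T := {a.1}) (letter_mem_span rfl) ?_)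
  exact fun e => hne (Set.mem_singleton_iff.mp e).symm

/-- Right multiplication by a letter changes the exponent of `y` only on the carrier of the wall
of `y`. -/
theorem of_lead_mul_letter_ne {y : V} {w : Grp Γ} {a : V × Bool}
    (h : lead Γ y (w * letter Γ a) ≠ lead Γ y w) : a.1 = y ∧ w ∈ span Γ (star Γ y) := by
  obtain ⟨l, hl, rfl⟩ := exists_reduced w
  induction l generalizing y with
  | nil =>
    refine ⟨vertex_eq_of_lead_letter_ne_zero (Γ := Γ) a ?_, one_mem _⟩
    simpa using h
  | cons b l ih =>
    by_cases hb : b.1 ∈ star Γ y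
    · obtain ⟨e, he⟩ := exists_lead_mul_eq_add (letter_mem_span (Γ := Γ) hb)
      rw [evalWord_cons, mul_assoc, he, he] at h
      obtain ⟨h1, h2⟩ := ih hl.2 (fun e' => h (by rw [e']))
      exact ⟨h1, evalWord_cons b l ▸ mul_mem (letter_mem_span hb) h2⟩
    -- The first letter blocks `y`, so the exponent of `y` must become nonzero. If the exponent of
    -- `b.1` survives the multiplication, it still blocks `y`. Otherwise induction applied to `b.1`
    -- in place of `y` puts the whole product in the star subgroup of `b.1`, which omits `y`.
    · exfalso
      have h0 := lead_cons_ne_zero hl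
      rw [lead_eq_zero_of_not_mem_star hb h0] at h
      by_cases hc : lead Γ b.1 (evalWord Γ l * letter Γ a) = lead Γ b.1 (evalWord Γ l)
      · refine h (lead_eq_zero_of_not_mem_star hb ?_)
        rwa [evalWord_cons, mul_assoc, lead_letter_mul, hc, ← lead_letter_mul, ← evalWord_cons]
      · obtain ⟨h1, h2⟩ := ih hl.2 hc
        refine h (lead_eq_zero_of_mem_span (T := star Γ b.1) ?_ (not_mem_star_comm hb))
        rw [evalWord_cons]
        exact mul_mem (mul_mem (letter_mem_span (self_mem_star _)) h2)
          (letter_mem_span (h1 ▸ self_mem_star _))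

theorem lead_mul_of_mem_span {T : Set V} {y : V} (hy : y ∉ T) {s : Grp Γ} (hs : s ∈ span Γ T)
    (w : Grp Γ) : lead Γ y (w * s) = lead Γ y w := by
  obtain ⟨l, rfl, hl⟩ := exists_evalWord_of_mem_span hs
  clear hs
  induction l generalizing w with
  | nil => simp
  | cons a l ih =>
    simp only [List.mem_cons, forall_eq_or_imp] at hl
    rw [evalWord_cons, ← mul_assoc, ih _ hl.2]
    by_contra h
    exact hy ((of_lead_mul_letter_ne h).1 ▸ hl.1)

/-- The centralizer of a generator is the subgroup generated by its star. -/
theorem mem_span_star_of_commute {x : V} {c : Grp Γ} (h : Commute c (gen Γ x)) :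
    c ∈ span Γ (star Γ x) := by
  obtain ⟨l, hl, rfl⟩ := exists_reduced c
  induction l with
  | nil => exact one_mem _
  | cons a l ih =>
    by_cases ha : a.1 ∈ star Γ x
    · have hm : letter Γ a ∈ span Γ (star Γ x) := letter_mem_span ha
      have hc := (commute_of_mem_span_star hm).inv_left.mul_left h
      rw [evalWord_cons, inv_mul_cancel_left] at hc
      exact evalWord_cons a l ▸ mul_mem hm (ih hl.2 hc)
    -- A leading letter outside `x^⊥` forces `x * c` to have leading `x`-exponent `1`, which blocks
    -- `a.1`. But `x * c = c * x`, and right multiplication by `x` does not change the exponent of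
    -- `a.1`.
    · exfalso
      have h0 := lead_cons_ne_zero hl
      have h1 := lead_letter_mul (x, true) (evalWord Γ (a :: l))
      rw [lead_eq_zero_of_not_mem_star ha h0] at h1
      have h2 : letter Γ (x, true) = gen Γ x := by simp [letter]
      rw [h2] at h1
      have h3 := lead_eq_zero_of_not_mem_star (not_mem_star_comm ha)
        (show lead Γ x (gen Γ x * evalWord Γ (a :: l)) ≠ 0 by rw [h1]; simp)
      rw [← h.eq, lead_mul_of_mem_span (T := {x}) (fun e => ha (Or.inl e)) (gen_mem_span rfl)] at h3
      exact h0 h3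

/-- The sector of `a` with respect to the wall of the conjugate `x ^ g`, relative to that
of `1`. -/
noncomputable def sector (x : V) (g a : Grp Γ) : ℤ := lead Γ x (g * a) - lead Γ x g

/-- Two conjugators differ by an element of the centralizer of `x`, which translates exponents by a
constant. Normalizing the sector of `1` to zero removes that constant. -/
theorem sector_congr {x : V} {g h : Grp Γ} (e : g⁻¹ * gen Γ x * g = h⁻¹ * gen Γ x * h) :
    sector x g = sector x h := by
  have hc : Commute (h * g⁻¹) (gen Γ x) := by
    calc h * g⁻¹ * gen Γ x = h * (g⁻¹ * gen Γ x * g) * g⁻¹ := by group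
      _ = gen Γ x * (h * g⁻¹) := by rw [e]; group
  obtain ⟨t, ht⟩ := exists_lead_mul_eq_add (mem_span_star_of_commute hc)
  have hg : h = h * g⁻¹ * g := by group
  funext a
  rw [sector, sector, hg, mul_assoc (h * g⁻¹), ht, ht]
  ring

variable (Γ) in
/-- The retraction killing the generators outside of `T`. -/
noncomputable def retract (T : Set V) : Grp Γ →* Grp Γ :=
  PresentedGroup.toGroup (rels := rels Γ) (f := fun z => if z ∈ T then gen Γ z else 1) (by
    rintro r ⟨a, b, h, rfl⟩
    have hc : Commute (if a ∈ T then gen Γ a else 1) (if b ∈ T then gen Γ b else 1) := by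
      split_ifs
      · exact gen_comm Γ h
      · exact .one_right _
      · exact .one_left _
      · exact .one_left _
    simp only [map_mul, map_inv, FreeGroup.lift_apply_of]
    rw [mul_assoc, hc.eq]
    group)

theorem retract_gen (T : Set V) (z : V) :
    retract Γ T (gen Γ z) = if z ∈ T then gen Γ z else 1 :=
  PresentedGroup.toGroup.of _

theorem retract_of_mem {T : Set V} {g : Grp Γ} (h : g ∈ span Γ T) : retract Γ T g = g := by
  induction h using Subgroup.closure_induction with
  | mem y hy =>
    obtain ⟨z, hz, rfl⟩ := hy
    rw [retract_gen, if_pos hz]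
  | one => simp
  | mul a b _ _ ha hb => simp [ha, hb]
  | inv a _ ha => simp [ha]

theorem retract_mem (T : Set V) (g : Grp Γ) : retract Γ T g ∈ span Γ T := by
  obtain ⟨l, rfl⟩ := exists_evalWord g
  induction l with
  | nil => simp [one_mem]
  | cons a l ih =>
    rw [evalWord_cons, map_mul, letter, map_zpow, retract_gen]
    refine mul_mem (zpow_mem ?_ _) ih
    split_ifs with h
    · exact gen_mem_span h
    · exact one_mem _

/-- Commuting conjugates of two adjacent generators are simultaneously conjugate to them. -/
theorem exists_common_conj {x y : V} (hxy : Γ.Adj x y) {g h : Grp Γ}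
    (hc : Commute (g⁻¹ * gen Γ x * g) (h⁻¹ * gen Γ y * h)) :
    ∃ f, f⁻¹ * gen Γ x * f = g⁻¹ * gen Γ x * g ∧ f⁻¹ * gen Γ y * f = h⁻¹ * gen Γ y * h := by
  have h1 : Commute ((h * g⁻¹)⁻¹ * gen Γ y * (h * g⁻¹)) (gen Γ x) := by
    have := hc.eq
    calc _ = g * ((h⁻¹ * gen Γ y * h) * (g⁻¹ * gen Γ x * g)) * g⁻¹ := by group
      _ = _ := by rw [← this]; group
  -- The conjugate of `y` by `h * g⁻¹` lies in the star subgroup of `x`, so the retraction fixes it.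
  -- Hence `h * g⁻¹` may be replaced by its retract `r`, which centralizes `x`, and `r * g`
  -- conjugates both generators correctly.
  have h2 := retract_of_mem (mem_span_star_of_commute h1)
  have hm := retract_mem (star Γ x) (h * g⁻¹)
  simp only [map_mul, map_inv, retract_gen] at h2
  rw [if_pos (show y ∈ star Γ x from Or.inr hxy)] at h2
  simp only [map_mul, map_inv] at hm
  set r := retract Γ (star Γ x) h * (retract Γ (star Γ x) g)⁻¹ with hr
  refine ⟨r * g, ?_, ?_⟩
  · have := (commute_of_mem_span_star hm).eq
    calc _ = g⁻¹ * (r⁻¹ * (gen Γ x * r)) * g := by group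
      _ = _ := by rw [← this]; group
  · calc _ = g⁻¹ * (r⁻¹ * gen Γ y * r) * g := by group
      _ = _ := by rw [h2]; group

theorem evalWord_append_singleton (l : List (V × Bool)) (a : V × Bool) :
    evalWord Γ (l ++ [a]) = evalWord Γ l * letter Γ a := by
  simp [evalWord]

/-- Moving inside the carrier of `x ^ g` uses only letters of `x^⊥`, never `y`, so it crosses no
wall of `y ^ h`. -/
theorem sector_eq_of_mem_carrier {x y : V} (hxy : y ∉ star Γ x) {g h a : Grp Γ}
    (ha : g * a ∈ span Γ (star Γ x)) : sector y h a = sector y h g⁻¹ := by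
  have e : h * a = h * g⁻¹ * (g * a) := by group
  rw [sector, sector, e, lead_mul_of_mem_span hxy ha]

theorem of_sector_mul_letter_ne {y : V} {g w : Grp Γ} {a : V × Bool}
    (h : sector y g (w * letter Γ a) ≠ sector y g w) :
    a.1 = y ∧ g * w ∈ span Γ (star Γ y) := by
  refine of_lead_mul_letter_ne fun e => h ?_
  rw [sector, sector, ← mul_assoc, e]

/-- Walls of non-adjacent distinct generators are nested. -/
theorem sector_nested {x y : V} (hxy : y ∉ star Γ x) (g h a : Grp Γ) :
    sector x g a = sector x g h⁻¹ ∨ sector y h a = sector y h g⁻¹ := by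
  have hyx := not_mem_star_comm hxy
  suffices H : ∀ l, sector x g (g⁻¹ * evalWord Γ l) = sector x g h⁻¹ ∨
      sector y h (g⁻¹ * evalWord Γ l) = sector y h g⁻¹ by
    obtain ⟨l, hl⟩ := exists_evalWord (g * a)
    have := H l
    rwa [hl, inv_mul_cancel_left] at this
  intro l
  induction l using List.reverseRecOn with
  | nil => simp
  | append_singleton l b ih =>
    rw [evalWord_append_singleton, ← mul_assoc]
    by_contra! H
    set p := g⁻¹ * evalWord Γ l
    -- Walking from `g⁻¹`, the alternative that held can only be lost by crossing its wall. That
    -- crossing happens inside its carrier, where the other alternative holds.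
    rcases ih with ih | ih
    · obtain ⟨h1, h2⟩ := of_sector_mul_letter_ne (ih ▸ H.1)
      refine H.2 (sector_eq_of_mem_carrier hxy ?_)
      rw [← mul_assoc]
      exact mul_mem h2 (letter_mem_span (h1 ▸ self_mem_star _))
    · obtain ⟨h1, h2⟩ := of_sector_mul_letter_ne (ih ▸ H.2)
      refine H.1 (sector_eq_of_mem_carrier hyx ?_)
      rw [← mul_assoc]
      exact mul_mem h2 (letter_mem_span (h1 ▸ self_mem_star _))

theorem sgn_mul_sgn_pos {a b : Bool} (h : 0 < sgn a * sgn b) : a = b := by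
  cases a <;> cases b <;> simp_all

/-- Crossing a wall back shortens a word. -/
theorem exists_shorter {y : V} {g : Grp Γ} {δ : Bool} (l : List (V × Bool))
    (h : 0 < sgn δ * sector y g (evalWord Γ l)) :
    ∃ l' : List (V × Bool), l'.length < l.length ∧
      evalWord Γ l' = (g⁻¹ * letter Γ (y, δ) * g)⁻¹ * evalWord Γ l := by
  induction l using List.reverseRecOn with
  | nil => simp [sector] at h
  | append_singleton l b ih =>
    -- The letter to delete is the one at the last crossing into the positive side. There it
    -- commutes with `g` times the prefix, so deleting it is left multiplication by the inverse of
    -- the conjugate.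
    by_cases hl : 0 < sgn δ * sector y g (evalWord Γ l)
    · obtain ⟨l', h1, h2⟩ := ih hl
      refine ⟨l' ++ [b], by simpa using h1, ?_⟩
      rw [evalWord_append_singleton, evalWord_append_singleton, h2, mul_assoc]
    · rw [evalWord_append_singleton] at h
      obtain ⟨h1, h2⟩ := of_sector_mul_letter_ne (y := y) (g := g) (w := evalWord Γ l) (a := b)
        (fun e => hl (e ▸ h))
      subst h1
      have hc : Commute (g * evalWord Γ l) (letter Γ b) :=
        (commute_of_mem_span_star h2).zpow_right _
      have h3 : sector b.1 g (evalWord Γ l * letter Γ b) =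
          sector b.1 g (evalWord Γ l) + sgn b.2 := by
        rw [sector, sector, ← mul_assoc, hc.eq, lead_letter_mul]
        ring
      rw [h3] at h
      have hb : δ = b.2 := sgn_mul_sgn_pos (by
        rw [mul_add] at h
        linarith)
      refine ⟨l, by simp, ?_⟩
      subst hb
      rw [evalWord_append_singleton]
      calc evalWord Γ l = g⁻¹ * (letter Γ b)⁻¹ * (letter Γ b * (g * evalWord Γ l)) := by group
        _ = _ := by rw [← hc.eq]; group

end Walls

/-! ### How conjugating automorphisms move walls -/

section Reduction

open Classical

variable {V : Type*} {Γ : SimpleGraph V}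

theorem sector_letter_mul_self (a : V × Bool) (g b : Grp Γ) :
    sector a.1 g ((g⁻¹ * letter Γ a * g) * b) = sector a.1 g b + sgn a.2 := by
  have e : g * ((g⁻¹ * letter Γ a * g) * b) = letter Γ a * (g * b) := by group
  rw [sector, sector, e, lead_letter_mul]
  ring

theorem sector_letter_mul_adj {a : V × Bool} {x : V} (h : Γ.Adj a.1 x) (g b : Grp Γ) :
    sector x g ((g⁻¹ * letter Γ a * g) * b) = sector x g b := by
  have e : g * ((g⁻¹ * letter Γ a * g) * b) = letter Γ a * (g * b) := by group
  rw [sector, sector, e, lead_letter_mul_adj h]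

theorem map_letter {φ : MulAut (Grp Γ)} {a : V × Bool} {g : Grp Γ}
    (h : φ (gen Γ a.1) = g⁻¹ * gen Γ a.1 * g) : φ (letter Γ a) = g⁻¹ * letter Γ a * g := by
  rw [letter, map_zpow, h]
  have := conj_zpow (i := sgn a.2) (a := g⁻¹) (b := gen Γ a.1)
  rwa [inv_inv] at this

/-- The position of the wall of `x ^ g` relative to the wall of `y ^ h` does not depend on the
choice of `g`. -/
theorem sector_inv_congr {x y : V} (hxy : y ∉ star Γ x) {f g : Grp Γ}
    (e : f⁻¹ * gen Γ x * f = g⁻¹ * gen Γ x * g) (h : Grp Γ) :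
    sector y h f⁻¹ = sector y h g⁻¹ := by
  refine sector_eq_of_mem_carrier hxy (mem_span_star_of_commute ?_)
  calc g * f⁻¹ * gen Γ x = g * (f⁻¹ * gen Γ x * f) * f⁻¹ := by group
    _ = gen Γ x * (g * f⁻¹) := by rw [e]; group

theorem lead_gen (x : V) : lead Γ x (gen Γ x) = 1 := by
  have := lead_letter_mul (Γ := Γ) (x, true) 1
  simpa [letter] using this

theorem eq_one_of_map_gen {φ : MulAut (Grp Γ)} (h : ∀ x, φ (gen Γ x) = gen Γ x) : φ = 1 :=
  MulEquiv.toMonoidHom_injective (PresentedGroup.ext h)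

/-- If no wall of an image separates `1` from another one, the automorphism preserves leading
exponents. -/
theorem sector_map_eq_lead {φ : MulAut (Grp Γ)} {g : V → Grp Γ}
    (hφ : ∀ x, φ (gen Γ x) = (g x)⁻¹ * gen Γ x * g x)
    (hs : ∀ x y, y ∉ star Γ x → sector y (g y) (g x)⁻¹ = 0) (x : V) (w : Grp Γ) :
    sector x (g x) (φ w) = lead Γ x w := by
  obtain ⟨l, hl, rfl⟩ := exists_reduced w
  induction l generalizing x with
  | nil => simp [sector]
  | cons a l ih =>
    have self : sector a.1 (g a.1) (φ (evalWord Γ (a :: l))) = lead Γ a.1 (evalWord Γ (a :: l)) := by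
      rw [evalWord_cons, map_mul, map_letter (hφ a.1), sector_letter_mul_self, lead_letter_mul,
        ih _ hl.2]
    by_cases hx : x ∈ star Γ a.1
    · rcases hx with rfl | hx
      · exact self
      -- With a common conjugator for both images, the image of the letter visibly does not move
      -- sectors of `x`.
      · have hc : Commute ((g a.1)⁻¹ * gen Γ a.1 * g a.1) ((g x)⁻¹ * gen Γ x * g x) := by
          rw [← hφ, ← hφ]
          exact (gen_comm Γ hx).map φ
        obtain ⟨f, h1, h2⟩ := exists_common_conj hx hc
        rw [evalWord_cons, map_mul, map_letter ((hφ a.1).trans h1.symm), ← sector_congr h2,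
          sector_letter_mul_adj hx, lead_letter_mul_adj hx, sector_congr h2, ih _ hl.2]
    · have h0 := lead_cons_ne_zero hl
      have hx' := not_mem_star_comm hx
      rw [lead_eq_zero_of_not_mem_star hx' h0]
      -- The first alternative would put the image in the zero sector of `a.1`, against its nonzero
      -- leading exponent; the second gives sector zero for `x`.
      rcases sector_nested hx (g a.1) (g x) (φ (evalWord Γ (a :: l))) with h | h
      · rw [self, hs _ _ hx'] at h
        exact absurd h h0
      · rw [h, hs _ _ hx]

/-- A nontrivial conjugating automorphism has a wall of an image that separates `1` from
another one. -/
theorem exists_sector_ne_zero {φ : MulAut (Grp Γ)} (h1 : φ ≠ 1) {g : V → Grp Γ}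
    (hφ : ∀ x, φ (gen Γ x) = (g x)⁻¹ * gen Γ x * g x) :
    ∃ x y, y ∉ star Γ x ∧ sector y (g y) (g x)⁻¹ ≠ 0 := by
  by_contra! hs
  refine h1 (eq_one_of_map_gen fun z => ?_)
  -- Some `y` leads the preimage `w`, so multiplying `1` by `z` crosses a wall of `y ^ g y`. A
  -- single letter crosses only walls of its own vertex, and only inside the carrier, so `y = z` and
  -- `g z` centralizes `z`.
  obtain ⟨w, hw⟩ := φ.surjective (gen Γ z)
  have hne : w ≠ 1 := by
    rintro rfl
    have := lead_gen (Γ := Γ) z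
    rw [← hw, map_one, lead_one] at this
    exact zero_ne_one this
  obtain ⟨y, hy⟩ := not_forall.mp (mt eq_one_of_lead_eq_zero hne)
  rw [← sector_map_eq_lead hφ hs, hw] at hy
  have h2 : letter Γ (z, true) = gen Γ z := by simp [letter]
  obtain ⟨rfl, h3⟩ := of_lead_mul_letter_ne (w := g y) (y := y) (a := (z, true))
    (by rw [h2]; exact sub_ne_zero.mp hy)
  have hc := commute_of_mem_span_star h3
  rw [hφ, mul_assoc, ← hc.eq, inv_mul_cancel_left]

/-! ### Descent on the total length of conjugators -/

/-- The smallest length of a word conjugating `r` to the generator `x`. -/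
noncomputable def conjLen (x : V) (r : Grp Γ) : ℕ :=
  sInf {n | ∃ l : List (V × Bool), l.length = n ∧
    r = ((evalWord Γ l)⁻¹)⁻¹ * gen Γ x * (evalWord Γ l)⁻¹}

/-- The position relative to the wall does not depend on the conjugator, so `exists_shorter` applies
to a shortest one. -/
theorem conjLen_lt {x y : V} (hxy : y ∉ star Γ x) {f g r : Grp Γ} {δ : Bool}
    (hr : r = f⁻¹ * gen Γ x * f) (h : 0 < sgn δ * sector y g f⁻¹) :
    conjLen x ((g⁻¹ * letter Γ (y, δ) * g)⁻¹ * r * (g⁻¹ * letter Γ (y, δ) * g)) <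
      conjLen x r := by
  have hne : {n | ∃ l : List (V × Bool), l.length = n ∧
      r = ((evalWord Γ l)⁻¹)⁻¹ * gen Γ x * (evalWord Γ l)⁻¹}.Nonempty := by
    obtain ⟨l, hl⟩ := exists_evalWord f⁻¹
    exact ⟨l.length, l, rfl, by rw [hl, inv_inv (f : Grp Γ), hr]⟩
  obtain ⟨l, hl, e⟩ := Nat.sInf_mem hne
  rw [sector_inv_congr hxy (hr.symm.trans e), inv_inv] at h
  obtain ⟨l', h1, h2⟩ := exists_shorter l h
  refine lt_of_le_of_lt (Nat.sInf_le ⟨l', rfl, ?_⟩) (h1.trans_eq hl)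
  rw [h2, e]
  group

/-- The total length of the conjugators of an automorphism. -/
noncomputable def totalLen [Fintype V] (φ : MulAut (Grp Γ)) : ℕ :=
  ∑ x, conjLen x (φ (gen Γ x))

/-- Since `φ` sends `y^δ` to its conjugate by `g y`, precomposing with `α` pulls every vertex of `S`
back across that wall and leaves the images of the others unchanged. -/
theorem totalLen_mul_lt [Fintype V] {φ α : MulAut (Grp Γ)} {g : V → Grp Γ}
    (hφ : ∀ x, φ (gen Γ x) = (g x)⁻¹ * gen Γ x * g x) {y x : V} {δ : Bool} {S : Set V}
    (hα : ∀ z, α (gen Γ z) =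
      if z ∈ S then (letter Γ (y, δ))⁻¹ * gen Γ z * letter Γ (y, δ) else gen Γ z)
    (hx : x ∈ S)
    (hS : ∀ z ∈ S, y ∉ star Γ z ∧ 0 < sgn δ * sector y (g y) (g z)⁻¹) :
    totalLen (φ * α) < totalLen φ := by
  have key : ∀ z ∈ S, conjLen z ((φ * α) (gen Γ z)) < conjLen z (φ (gen Γ z)) := by
    intro z hz
    rw [MulAut.mul_apply, hα, if_pos hz, map_mul, map_mul, map_inv,
      map_letter (a := (y, δ)) (hφ y)]
    exact conjLen_lt (hS z hz).1 (hφ z) (hS z hz).2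
  refine Finset.sum_lt_sum (fun z _ => ?_) ⟨x, Finset.mem_univ _, key x hx⟩
  by_cases hz : z ∈ S
  · exact (key z hz).le
  · rw [MulAut.mul_apply, hα, if_neg hz]

/-- A subgroup lies in another one if right multiplication by elements of both always
decreases the total length. -/
theorem le_of_totalLen_lt [Fintype V] {H K : Subgroup (MulAut (Grp Γ))}
    (h : ∀ φ ∈ H, φ ≠ 1 → ∃ α ∈ H ⊓ K, totalLen (φ * α) < totalLen φ) : H ≤ K := by
  intro φ hφ
  induction hn : totalLen φ using Nat.strong_induction_on generalizing φ with
  | _ n ih =>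
    by_cases h1 : φ = 1
    · exact h1 ▸ one_mem _
    · obtain ⟨α, hα, hlt⟩ := h φ hφ h1
      exact (Subgroup.mul_mem_cancel_right K hα.2).mp
        (ih _ (hn ▸ hlt) (mul_mem hφ hα.1) rfl)

/-! ### Components of `Γ ∖ y^⊥` and vertex classes -/

theorem exists_isComponent {x y : V} (h : x ∉ star Γ y) :
    ∃ C, IsComponent Γ y C ∧ x ∈ C :=
  ⟨_, ⟨(Γ.induce (star Γ y)ᶜ).connectedComponentMk ⟨x, h⟩, rfl⟩, ⟨x, h⟩, rfl, rfl⟩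

/-- A property that passes to neighbours outside of the star spreads over the component. -/
theorem IsComponent.induction {y x : V} {C : Set V} (hC : IsComponent Γ y C) (hx : x ∈ C)
    {p : V → Prop} (h0 : p x)
    (hs : ∀ a b, a ∈ C → b ∈ C → Γ.Adj a b → p a → p b) {z : V} (hz : z ∈ C) : p z := by
  have hC' := hC
  obtain ⟨c, rfl⟩ := hC
  obtain ⟨x, hxc, rfl⟩ := hx
  obtain ⟨z, hzc, rfl⟩ := hz
  obtain ⟨w⟩ := SimpleGraph.ConnectedComponent.exact (hxc.trans hzc.symm)
  clear hzc
  induction w with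
  | nil => exact h0
  | @cons a b _ hab _ ih =>
    have ha : a.1 ∈ Subtype.val '' c.supp := ⟨a, hxc, rfl⟩
    have hb := hC'.mem_of_adj hab ha b.2
    have hbc : b ∈ c.supp := by
      obtain ⟨b', hb', e⟩ := hb
      exact Subtype.ext e ▸ hb'
    exact ih hbc (hs _ _ ha hb hab h0)

theorem IsComponent.exists_adj {y x : V} {C : Set V} (hC : IsComponent Γ y C) (hx : x ∈ C)
    (hne : C ≠ {x}) : ∃ z ∈ C, Γ.Adj x z := by
  by_contra! h
  refine hne (Set.eq_singleton_iff_unique_mem.mpr ⟨hx, fun z hz => ?_⟩)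
  exact hC.induction (p := fun z => z = x) hx rfl
    (fun a b _ hb hab e => absurd hab (e ▸ h b hb)) hz

/-- The images of two adjacent vertices have a common conjugator, so their carriers meet and lie in
one sector of `y`; this spreads along paths in `C`. -/
theorem sector_eq_of_mem_isComponent {φ : MulAut (Grp Γ)} {g : V → Grp Γ}
    (hφ : ∀ x, φ (gen Γ x) = (g x)⁻¹ * gen Γ x * g x) {y x z : V} {C : Set V}
    (hC : IsComponent Γ y C) (hx : x ∈ C) (hz : z ∈ C) :
    sector y (g y) (g z)⁻¹ = sector y (g y) (g x)⁻¹ := by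
  refine hC.induction (p := fun z => sector y (g y) (g z)⁻¹ = sector y (g y) (g x)⁻¹) hx rfl
    (fun a b ha hb hab e => ?_) hz
  have hc : Commute ((g a)⁻¹ * gen Γ a * g a) ((g b)⁻¹ * gen Γ b * g b) := by
    rw [← hφ, ← hφ]
    exact (gen_comm Γ hab).map φ
  obtain ⟨f, h1, h2⟩ := exists_common_conj hab hc
  rw [← e, ← sector_inv_congr (not_mem_star_comm (hC.disjoint ha)) h1,
    ← sector_inv_congr (not_mem_star_comm (hC.disjoint hb)) h2]

theorem exists_sgn_mul_pos {n : ℤ} (h : n ≠ 0) : ∃ δ : Bool, 0 < sgn δ * n := by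
  rcases lt_or_gt_of_ne h with h | h
  · exact ⟨false, by simpa using h⟩
  · exact ⟨true, by simpa using h⟩

/-- A sign as a unit of the integers. -/
def sgnUnit (b : Bool) : ℤˣ := cond b 1 (-1)

theorem coe_sgnUnit (b : Bool) : (sgnUnit b : ℤ) = sgn b := by cases b <;> rfl

theorem elemConj_gen_letter {y : V} {C : Set V} (hC : IsComponent Γ y C) (δ : Bool) (z : V) :
    elemConj Γ y C hC (sgnUnit δ) (gen Γ z) =
      if z ∈ C then (letter Γ (y, δ))⁻¹ * gen Γ z * letter Γ (y, δ) else gen Γ z := by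
  rw [elemConj_gen, coe_sgnUnit]
  rfl

theorem VEquiv.refl (a : V) : VEquiv Γ a a := Or.inl rfl

theorem VEquiv.symm {a b : V} (h : VEquiv Γ a b) : VEquiv Γ b a :=
  h.imp Eq.symm Eq.symm

theorem mem_star_comm {a b : V} : b ∈ star Γ a ↔ a ∈ star Γ b :=
  ⟨fun h => by_contra fun h' => not_mem_star_comm h' h,
    fun h => by_contra fun h' => not_mem_star_comm h' h⟩

/-- Equal stars and equal links are separately transitive. A vertex cannot share its star with one
other vertex and its link with another, so in the mixed case two of the three coincide. -/
theorem VEquiv.trans {a b c : V} (h : VEquiv Γ a b) (h' : VEquiv Γ b c) : VEquiv Γ a c := by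
  have mixed : ∀ {a b c : V}, star Γ a = star Γ b → star Γ b \ {b} = star Γ c \ {c} →
      VEquiv Γ a c := by
    intro a b c h1 h2
    by_cases hab : a = b
    · exact Or.inr (hab ▸ h2)
    by_cases hbc : c = b
    · exact Or.inl (hbc ▸ h1)
    exfalso
    have h3 : a ∈ star Γ c \ {c} := h2 ▸ ⟨h1 ▸ self_mem_star a, hab⟩
    have h4 : c ∈ star Γ c \ {c} := h2 ▸ ⟨h1 ▸ mem_star_comm.mp h3.1, hbc⟩
    exact h4.2 rfl
  rcases h with h | h <;> rcases h' with h' | h'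
  · exact Or.inl (h.trans h')
  · exact mixed h h'
  · exact (mixed h'.symm h.symm).symm
  · exact Or.inr (h.trans h')

/-- With equal stars, `a` and `b` are equal or adjacent. With equal links they share a neighbour
inside `C`, which exists because `C` is not a singleton. Hence non-singleton components are unions
of classes. -/
theorem IsComponent.mem_of_vequiv {y a b : V} {C : Set V} (hC : IsComponent Γ y C)
    (hne : C ≠ {a}) (ha : a ∈ C) (h : VEquiv Γ a b) : b ∈ C := by
  by_cases hab : b = a
  · exact hab ▸ ha
  have hay := hC.disjoint ha
  rcases h with h | h
  · have hb : b ∈ star Γ a := h ▸ self_mem_star b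
    refine hC.mem_of_adj (hb.resolve_left hab) ha fun hby => ?_
    exact hay (mem_star_comm.mp (h ▸ mem_star_comm.mp hby))
  · obtain ⟨c, hc, hac⟩ := hC.exists_adj ha hne
    have hcb : c ∈ star Γ b \ {b} := h ▸ ⟨Or.inr hac, hac.ne'⟩
    refine hC.mem_of_adj ((hcb.1.resolve_left hcb.2).symm) hc fun hby => ?_
    rcases hby with rfl | hby
    · exact hC.disjoint hc hcb.1
    · have : y ∈ star Γ a \ {a} := h ▸ ⟨Or.inr hby.symm, hby.ne⟩
      exact hay (mem_star_comm.mp this.1)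

/-- An automorphism conjugating a union of classes by one element and fixing the other generators
is vertex conjugating. -/
theorem mem_ConjV_of_gen {α : MulAut (Grp Γ)} {f : Grp Γ} {S : Set V}
    (hS : ∀ a ∈ S, ∀ b, VEquiv Γ a b → b ∈ S)
    (h : ∀ z, α (gen Γ z) = if z ∈ S then f⁻¹ * gen Γ z * f else gen Γ z) : α ∈ ConjV Γ := by
  have key : ∀ x, ∃ f : Grp Γ, ∀ y ∈ vclass Γ x, α (gen Γ y) = f⁻¹ * gen Γ y * f := by
    intro x
    by_cases hx : x ∈ S
    · exact ⟨f, fun y hy => by rw [h, if_pos (hS x hx y hy)]⟩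
    · exact ⟨1, fun y hy => by
        rw [h, if_neg fun hyS => hx (hS y hyS x (VEquiv.symm hy))]
        simp⟩
  refine ⟨fun x => ?_, key⟩
  obtain ⟨f, hf⟩ := key x
  exact ⟨f, hf x (VEquiv.refl x)⟩

theorem elemConj_mem_LInnR {y : V} {C : Set V} (hC : IsComponent Γ y C)
    (hne : ∀ a, C ≠ {a}) (δ : Bool) : elemConj Γ y C hC (sgnUnit δ) ∈ LInnR Γ := by
  refine ⟨⟨⟨y, C, hC, _, rfl⟩, mem_ConjV_of_gen (f := letter Γ (y, δ)) (S := C)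
    (fun a ha b hab => hC.mem_of_vequiv (hne a) ha hab) (elemConj_gen_letter hC δ)⟩, ?_⟩
  rintro ⟨x, u, hu, ε, e⟩
  obtain ⟨c, hc⟩ : C.Nonempty := by
    obtain ⟨c, rfl⟩ := hC
    exact c.nonempty_supp.image _
  -- A singular automorphism moves at most one generator, while this one moves every generator in
  -- `C`; any second element of `C` gives the contradiction.
  obtain ⟨z, hz, hzu⟩ : ∃ z ∈ C, z ≠ u := by
    by_contra! h
    exact hne u (Set.eq_singleton_iff_unique_mem.mpr ⟨h c hc ▸ hc, h⟩)
  have h1 := elemConj_gen_letter hC δ z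
  rw [e, elemConj_gen, if_neg (by simpa using hzu), if_pos hz] at h1
  have h2 : Commute (letter Γ (y, δ)) (gen Γ z) := by
    change _ * _ = _ * _
    conv_lhs => rw [h1]
    group
  have h3 := mem_span_star_of_commute h2
  have h4 : lead Γ y (letter Γ (y, δ)) = sgn δ := by
    simpa using lead_letter_mul (Γ := Γ) (y, δ) 1
  rw [lead_eq_zero_of_mem_span h3 (not_mem_star_comm (hC.disjoint hz))] at h4
  cases δ <;> simp at h4

theorem dominates_iff {y x : V} :
    Dominates Γ y x ↔ x ∉ star Γ y ∧ ∀ w, Γ.Adj x w → Γ.Adj y w := by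
  constructor
  · intro h
    have hx : x ∉ star Γ y := fun hx => by
      have : x ∈ star Γ x \ {x} := h ▸ ⟨hx, self_mem_star x⟩
      exact this.2 rfl
    refine ⟨hx, fun w hw => ?_⟩
    have : w ∈ star Γ y ∩ star Γ x := h.symm ▸ ⟨Or.inr hw, hw.ne'⟩
    refine this.1.resolve_left ?_
    rintro rfl
    exact hx (Or.inr hw.symm)
  · rintro ⟨hx, h⟩
    ext w
    constructor
    · rintro ⟨h1, h2⟩
      exact ⟨h2, fun e => hx (Set.mem_singleton_iff.mp e ▸ h1)⟩
    · rintro ⟨h1, h2⟩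
      exact ⟨Or.inr (h w (h1.resolve_left h2)), h1⟩

theorem IsComponent.dominates {y x : V} (h : IsComponent Γ y {x}) : Dominates Γ y x := by
  have hx := h.disjoint rfl
  refine dominates_iff.mpr ⟨hx, fun w hw => ?_⟩
  have hws : w ∈ star Γ y := by
    by_contra hws
    exact hw.ne' (h.mem_of_adj hw rfl hws)
  refine hws.resolve_left ?_
  rintro rfl
  exact hx (Or.inr hw.symm)

/-! ### Collected conjugating automorphisms -/

theorem noncommProd_elemConj_gen {y : V} {ι : Type*} {v : ι → V}
    (hv : ∀ i, IsComponent Γ y {v i}) (hinj : Function.Injective v) (s : Finset ι)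
    (hs : (s : Set ι).Pairwise (Function.onFun Commute fun i => elemConj Γ y {v i} (hv i) 1))
    (z : V) :
    s.noncommProd (fun i => elemConj Γ y {v i} (hv i) 1) hs (gen Γ z) =
      if ∃ i ∈ s, v i = z then (gen Γ y)⁻¹ * gen Γ z * gen Γ y else gen Γ z := by
  induction s using Finset.induction_on with
  | empty => simp
  | insert i s hi ih =>
    have hy : elemConj Γ y {v i} (hv i) 1 (gen Γ y) = gen Γ y := partialConjHom_gen_self (hv i) _
    rw [Finset.noncommProd_insert_of_notMem _ _ _ _ hi, MulAut.mul_apply, ih]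
    by_cases hz : v i = z
    · have h1 : ¬ ∃ j ∈ s, v j = z := by
        rintro ⟨j, hj, e⟩
        exact hi (hinj (hz.trans e.symm) ▸ hj)
      rw [if_neg h1, if_pos ⟨i, Finset.mem_insert_self _ _, hz⟩, elemConj_gen,
        if_pos (Set.mem_singleton_iff.mpr hz.symm)]
      simp
    · have h1 : (∃ j ∈ insert i s, v j = z) ↔ ∃ j ∈ s, v j = z := by
        simp [hz]
      have h2 : elemConj Γ y {v i} (hv i) 1 (gen Γ z) = gen Γ z := by
        rw [elemConj_gen, if_neg fun e => hz (Set.mem_singleton_iff.mp e).symm]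
      simp only [h1]
      split_ifs <;> simp [hy, h2]

theorem collectedConj_gen [Finite V] {y x : V} (h : Dominates Γ y x) (z : V) :
    collectedConj Γ y x h (gen Γ z) =
      if z ∈ vclass Γ x \ {y} then (gen Γ y)⁻¹ * gen Γ z * gen Γ y else gen Γ z := by
  rw [collectedConj, noncommProd_elemConj_gen _ Subtype.val_injective]
  congr 1
  simp

theorem collectedConj_inv_gen [Finite V] {y x : V} (h : Dominates Γ y x) (z : V) :
    (collectedConj Γ y x h)⁻¹ (gen Γ z) =
      if z ∈ vclass Γ x \ {y} then gen Γ y * gen Γ z * (gen Γ y)⁻¹ else gen Γ z := by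
  have hy : collectedConj Γ y x h (gen Γ y) = gen Γ y := by simp [collectedConj_gen]
  refine (collectedConj Γ y x h).injective ?_
  rw [MulAut.apply_inv_self]
  have hz := collectedConj_gen h z
  split_ifs at hz ⊢
  · rw [map_mul, map_mul, map_inv, hy, hz]
    group
  · exact hz.symm

theorem collectedConj_mem_ConjV [Finite V] {y x : V} (h : Dominates Γ y x) :
    collectedConj Γ y x h ∈ ConjV Γ := by
  -- The full class can be used even if it contains `y`, because conjugating `y` by itself is
  -- trivial.
  refine mem_ConjV_of_gen (f := gen Γ y) (S := vclass Γ x) (fun a ha b hab => VEquiv.trans ha hab)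
    fun z => ?_
  rw [collectedConj_gen]
  by_cases hzy : z = y
  · simp [hzy]
  · simp [hzy]

theorem ConjC_le_ConjV [Finite V] : ConjC Γ ≤ ConjV Γ := by
  rw [ConjC, Subgroup.closure_le]
  rintro _ ⟨y, x, h, rfl⟩
  exact collectedConj_mem_ConjV h

theorem ConjC_le_ConjS [Finite V] : ConjC Γ ≤ ConjS Γ := by
  rw [ConjC, Subgroup.closure_le]
  rintro _ ⟨y, x, h, rfl⟩
  exact Subgroup.noncommProd_mem _ _ fun v _ =>
    Subgroup.subset_closure ⟨y, v.1, h.isComponent ((Set.Finite.mem_toFinset _).mp v.2), 1, rfl⟩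

/-- One conjugator serves all of `[x]`, so every vertex of `[x] ∖ {y}` lies in the same sector of
`y` and all are shortened together. -/
theorem exists_collected_totalLen_lt [Fintype V] {φ : MulAut (Grp Γ)} (hV : φ ∈ ConjV Γ)
    {g : V → Grp Γ} (hφ : ∀ x, φ (gen Γ x) = (g x)⁻¹ * gen Γ x * g x) {x y : V}
    (hd : Dominates Γ y x) (hs : sector y (g y) (g x)⁻¹ ≠ 0) :
    ∃ α ∈ ConjC Γ, totalLen (φ * α) < totalLen φ := by
  obtain ⟨δ, hδ⟩ := exists_sgn_mul_pos hs
  have hc : collectedConj Γ y x hd ∈ ConjC Γ := Subgroup.subset_closure ⟨y, x, hd, rfl⟩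
  obtain ⟨f, hf⟩ := hV.2 x
  have hmem : x ∈ vclass Γ x \ {y} :=
    ⟨VEquiv.refl x, fun e => (dominates_iff.mp hd).1 (Or.inl e)⟩
  have hdisj : ∀ z ∈ vclass Γ x \ {y}, y ∉ star Γ z := fun z hz =>
    not_mem_star_comm ((hd.isComponent hz).disjoint rfl)
  have hS : ∀ z ∈ vclass Γ x \ {y}, y ∉ star Γ z ∧ 0 < sgn δ * sector y (g y) (g z)⁻¹ := by
    intro z hz
    refine ⟨hdisj z hz, ?_⟩
    rwa [sector_inv_congr (hdisj z hz) ((hφ z).symm.trans (hf z hz.1)),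
      ← sector_inv_congr (hdisj x hmem) ((hφ x).symm.trans (hf x hmem.1))]
  -- Basic collected automorphisms conjugate by `y` only, so the negative sign uses the inverse.
  cases δ
  · refine ⟨_, inv_mem hc, totalLen_mul_lt (y := y) (δ := false) hφ (fun z => ?_) hmem hS⟩
    rw [collectedConj_inv_gen]
    simp [letter]
  · refine ⟨_, hc, totalLen_mul_lt (y := y) (δ := true) hφ (fun z => ?_) hmem hS⟩
    rw [collectedConj_gen]
    simp [letter]

/-! ### Conjugators arising from singular automorphisms -/

/-- The vertices whose links contain the link of `u`. -/
def linkAbove (Γ : SimpleGraph V) (u : V) : Set V := {z | ∀ w, Γ.Adj u w → Γ.Adj z w}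

theorem linkAbove_subset {u z : V} (h : z ∈ linkAbove Γ u) : linkAbove Γ z ⊆ linkAbove Γ u :=
  fun _ hv w hw => hv w (h w hw)

theorem span_mono {S T : Set V} (h : S ⊆ T) : span Γ S ≤ span Γ T :=
  Subgroup.closure_mono (Set.image_mono h)

theorem map_mem_span_linkAbove {φ : MulAut (Grp Γ)}
    (h : ∀ u, ∃ f ∈ span Γ (linkAbove Γ u), φ (gen Γ u) = f⁻¹ * gen Γ u * f) {u : V} {g : Grp Γ}
    (hg : g ∈ span Γ (linkAbove Γ u)) : φ g ∈ span Γ (linkAbove Γ u) := by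
  induction hg using Subgroup.closure_induction with
  | mem y hy =>
    obtain ⟨z, hz, rfl⟩ := hy
    obtain ⟨f, hf, e⟩ := h z
    have hf' := span_mono (linkAbove_subset hz) hf
    rw [e]
    exact mul_mem (mul_mem (inv_mem hf') (gen_mem_span hz)) hf'
  | one => simp [one_mem]
  | mul a b _ _ ha hb => simpa using mul_mem ha hb
  | inv a _ ha => simpa using ha

theorem elemConj_inv {x : V} {C : Set V} (hC : IsComponent Γ x C) (ε : ℤˣ) :
    (elemConj Γ x C hC ε)⁻¹ = elemConj Γ x C hC (-ε) :=
  MulEquiv.ext fun _ => rfl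

theorem elemConj_singleton_conj {x v : V} (hC : IsComponent Γ x {v}) (ε : ℤˣ) (u : V) :
    ∃ f ∈ span Γ (linkAbove Γ u), elemConj Γ x {v} hC ε (gen Γ u) = f⁻¹ * gen Γ u * f := by
  by_cases huv : u ∈ ({v} : Set V)
  · refine ⟨gen Γ x ^ (ε : ℤ), zpow_mem (gen_mem_span ?_) _, by rw [elemConj_gen, if_pos huv]⟩
    rw [Set.mem_singleton_iff.mp huv]
    exact (dominates_iff.mp hC.dominates).2
  · exact ⟨1, one_mem _, by rw [elemConj_gen, if_neg huv]; simp⟩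

/-- A singleton component `{v}` of `Γ ∖ x^⊥` means that `x` dominates `v`. Link inclusion is
transitive, so this bound on conjugators survives composition. -/
theorem exists_conj_of_mem_ConjS {φ : MulAut (Grp Γ)} (h : φ ∈ ConjS Γ) (u : V) :
    ∃ f ∈ span Γ (linkAbove Γ u), φ (gen Γ u) = f⁻¹ * gen Γ u * f := by
  have mul : ∀ {α ψ : MulAut (Grp Γ)},
      (∀ u, ∃ f ∈ span Γ (linkAbove Γ u), α (gen Γ u) = f⁻¹ * gen Γ u * f) →
      (∀ u, ∃ f ∈ span Γ (linkAbove Γ u), ψ (gen Γ u) = f⁻¹ * gen Γ u * f) →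
      ∀ u, ∃ f ∈ span Γ (linkAbove Γ u), (α * ψ) (gen Γ u) = f⁻¹ * gen Γ u * f := by
    intro α ψ hα hψ u
    obtain ⟨a, ha, ea⟩ := hα u
    obtain ⟨b, hb, eb⟩ := hψ u
    exact ⟨_, mul_mem ha (map_mem_span_linkAbove hα hb), conj_mul_aux ea eb⟩
  induction h using Subgroup.closure_induction_left generalizing u with
  | one => exact ⟨1, one_mem _, by simp⟩
  | mul_left α hα ψ _ ih =>
    obtain ⟨x, v, hC, ε, rfl⟩ := hα
    exact mul (elemConj_singleton_conj hC ε) ih u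
  | inv_mul_cancel α hα ψ _ ih =>
    obtain ⟨x, v, hC, ε, rfl⟩ := hα
    rw [elemConj_inv]
    exact mul (elemConj_singleton_conj hC _) ih u

/-! ### The generating set and the intersection -/

theorem ConjV_le_closure [Finite V] :
    ConjV Γ ≤ Subgroup.closure (LInnR Γ ∪ LInnC Γ) := by
  have := Fintype.ofFinite V
  refine le_of_totalLen_lt fun φ hφ h1 => ?_
  choose g hg using hφ.1
  obtain ⟨x, y, hxy, hs⟩ := exists_sector_ne_zero h1 hg
  obtain ⟨C, hC, hx⟩ := exists_isComponent (not_mem_star_comm hxy)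
  -- A singleton component means domination and calls for a collected automorphism; any other
  -- component gives a regular one.
  by_cases hsing : ∃ a, C = {a}
  · obtain ⟨a, rfl⟩ := hsing
    obtain rfl : x = a := hx
    obtain ⟨α, hα, hlt⟩ := exists_collected_totalLen_lt hφ hg hC.dominates hs
    exact ⟨α, ⟨ConjC_le_ConjV hα, Subgroup.closure_mono Set.subset_union_right hα⟩, hlt⟩
  · obtain ⟨δ, hδ⟩ := exists_sgn_mul_pos hs
    have hα := elemConj_mem_LInnR hC (fun a e => hsing ⟨a, e⟩) δ
    refine ⟨_, ⟨hα.1.2, Subgroup.subset_closure (Or.inl hα)⟩,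
      totalLen_mul_lt hg (elemConj_gen_letter hC δ) hx fun z hz =>
        ⟨not_mem_star_comm (hC.disjoint hz), ?_⟩⟩
    rwa [sector_eq_of_mem_isComponent hg hC hx hz]

theorem ConjV_inf_ConjS_le [Finite V] : ConjV Γ ⊓ ConjS Γ ≤ ConjC Γ := by
  have := Fintype.ofFinite V
  refine le_of_totalLen_lt fun φ hφ h1 => ?_
  choose g hgs hg using exists_conj_of_mem_ConjS hφ.2
  obtain ⟨x, y, hxy, hs⟩ := exists_sector_ne_zero h1 hg
  -- The conjugator `g x` uses only letters from `linkAbove Γ x`, so the carrier of `x` can be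
  -- separated from `1` only by a wall of such a vertex.
  have hy : y ∈ linkAbove Γ x := by
    by_contra hy
    exact hs (sub_eq_zero.mpr (lead_mul_of_mem_span hy (inv_mem (hgs x)) _))
  obtain ⟨α, hα, hlt⟩ := exists_collected_totalLen_lt hφ.1 hg
    (dominates_iff.mpr ⟨not_mem_star_comm hxy, hy⟩) hs
  exact ⟨α, ⟨⟨ConjC_le_ConjV hα, ConjC_le_ConjS hα⟩, hα⟩, hlt⟩

end Reduction

end PartComm

theorem proposition3p29 {V : Type*} [Finite V] (Γ : SimpleGraph V) :
    Subgroup.closure (PartComm.LInnR Γ ∪ PartComm.LInnC Γ) = PartComm.ConjV Γ ∧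
      PartComm.ConjV Γ ⊓ PartComm.ConjS Γ = PartComm.ConjC Γ := by
  refine ⟨le_antisymm ?_ PartComm.ConjV_le_closure, le_antisymm PartComm.ConjV_inf_ConjS_le
    (le_inf PartComm.ConjC_le_ConjV PartComm.ConjC_le_ConjS)⟩
  rw [Subgroup.closure_le]
  refine Set.union_subset (fun α h => h.1.2) fun α h => ?_
  exact PartComm.ConjC_le_ConjV (Subgroup.subset_closure h)
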